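/- Let $n\ge 1$ and let $\Omega\subset\mathbb{R}^n$ be a bounded and strictly convex domain with smooth boundary (i.e. $\Omega$ is nonempty, open, bounded and convex, $\partial\Omega$ is $C^\infty$ and contains no nondegenerate segment). For every $x^0\in\partial\Omega$, with unit inward normal vector $\nu^0$ of $\partial\Omega$ at $x^0$, there exists a constant $\delta_0>0$ depending only on $x^0$ and $\Omega$ such that the following holds. Let $s=s_0+s_1$ and $t=t_0+t_1$ with integers $s_0,t_0\ge 1$ and $s_1,t_1\in(0,1)$, let $p,q\ge 1$ be real, and let $u,v:\mathbb{R}^n\to\mathbb{R}$, positive in $\Omega$, satisfy $$u\in C^{2s_0+[2s_1],\{2s_1\}+\varepsilon}_{loc}(\Omega)\cap C^{2s_0}(\overline\Omega),\qquad v\in C^{2t_0+[2t_1],\{2t_1\}+\varepsilon}_{loc}(\Omega)\cap C^{2t_0}(\overline\Omega)$$ for some (arbitrarily small) $\varepsilon>0$, where $[\cdot]$ and $\{\cdot\}$ denote the integer and the fractional part, and $$ \begin{cases} (-\Delta)^s u(x)=v^p(x),&x\in\Omega,\\ (-\Delta)^t v(x)=u^q(x),&x\in\Omega,\\ u(x)=-\Delta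 u(x)=\cdots=(-\Delta)^{s_0}u(x)=0,&x\in\mathbb{R}^n\setminus\Omega,\\ v(x)=-\Delta v(x)=\cdots=(-\Delta)^{t_0}v(x)=0,&x\in\mathbb{R}^n\setminus\Omega. \end{cases} $$ Then $(-\Delta)^i u$ $(i=0,\dots,s_0)$ and $(-\Delta)^j v$ $(j=0,\dots,t_0)$ are strictly monotone increasing along the direction $\nu^0$ in the region $$\tilde\Sigma_{\delta_0}=\{x\in\overline\Omega\mid 0\le (x-x^0)\cdot\nu^0\le\delta_0\},$$ that is, each of these functions $f$ satisfies $f(x)<f(x+h\nu^0)$ whenever $h>0$ and $x,\,x+h\nu^0\in\tilde\Sigma_{\delta_0}$. Here the values of $(-\Delta)^i u$ on $\partial\Omega$ are those of its continuous extension from $\Omega$ to $\overline\Omega$ (likewise for $v$); $(-\Delta)^s u:=(-\Delta)^{s_1}\big((-\Delta)^{s_0}u\big)$ and likewise for $(-\Delta)^t v$; and for $0<\sigma<1$ and $w\in L^1_{loc}(\mathbb{R}^n)$ with $\int_{\mathbb{R}^n}\frac{|w(x)|}{1+|x|^{n+2\sigma}}\,dx<\infty$, $$(-\Delta)^\sigma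 w(x)=C_{n,\sigma}\lim_{\delta\to0^+}\int_{\mathbb{R}^n\setminus B_\delta(x)}\frac{w(x)-w(y)}{|x-y|^{n+2\sigma}}\,dy,\qquad C_{n,\sigma}=\frac{4^\sigma\,\sigma\,\Gamma(\frac n2+\sigma)}{\pi^{n/2}\,\Gamma(1-\sigma)}.$$ -/

import Mathlib

open Set Filter Topology MeasureTheory
open scoped ContDiff

noncomputable section

/-- The Euclidean space `ℝⁿ`. -/
abbrev En (n : ℕ) : Type := EuclideanSpace ℝ (Fin n)

/-- `ρ` is a smooth function that defines `Ω` near the boundary point `x`: near `x` it is `C^∞`,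
`Ω` is the set where it is positive, and its derivative at `x` does not vanish. -/
structure IsLocalDefiningFunction {n : ℕ} (Ω : Set (En n)) (x : En n) (ρ : En n → ℝ) : Prop where
  smooth : ∃ U ∈ 𝓝 x, ContDiffOn ℝ ∞ ρ U
  zero : ρ x = 0
  grad_ne_zero : gradient ρ x ≠ 0
  eventually_mem_iff : ∀ᶠ y in 𝓝 x, (y ∈ Ω ↔ 0 < ρ y)

/-- A bounded, strictly convex domain with smooth boundary. Strict convexity is a condition on the
closure: the boundary contains no segment (for an open set, `StrictConvex ℝ Ω` is just convexity). -/
structure IsSmoothStrictlyConvexDomain {n : ℕ} (Ω : Set (En n)) : Prop where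
  isOpen : IsOpen Ω
  nonempty : Ω.Nonempty
  isBounded : Bornology.IsBounded Ω
  convex : Convex ℝ Ω
  strictConvex_closure : StrictConvex ℝ (closure Ω)
  smooth_boundary : ∀ x ∈ frontier Ω, ∃ ρ : En n → ℝ, IsLocalDefiningFunction Ω x ρ

/-- `ν` is the unit inward normal of `∂Ω` at `x`: the normalized gradient of a local defining
function of `Ω` at `x`. -/
def IsInwardUnitNormal {n : ℕ} (Ω : Set (En n)) (x ν : En n) : Prop :=
  ∃ ρ : En n → ℝ, IsLocalDefiningFunction Ω x ρ ∧ ν = ‖gradient ρ x‖⁻¹ • gradient ρ x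

/-- The function `(-Δ)^i u` on `ℝⁿ` for `u` that is `C^{2i}` up to the boundary of `Ω` and smooth
outside `closure Ω`. In `Ω` and in the exterior of `Ω` it is the classical iterated Laplacian; at
points of `∂Ω` the derivatives are those of `u` on `closure Ω`, that is, the continuous extensions
of the derivatives in `Ω`. -/
def iterNegLaplacian {n : ℕ} (Ω : Set (En n)) (i : ℕ) (u : En n → ℝ) (x : En n) : ℝ :=
  open Classical in
  if x ∈ closure Ω then
    ((fun (f : En n → ℝ) (y : En n) =>
      -InnerProductSpace.laplacianWithin f (closure Ω) y)^[i] u) x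
  else
    ((fun (f : En n → ℝ) (y : En n) => -Laplacian.laplacian f y)^[i] u) x

/-- The class `C^{k,α}_loc(Ω)`. -/
def MemHolderLoc {n : ℕ} (k : ℕ) (α : ℝ) (Ω : Set (En n)) (u : En n → ℝ) : Prop :=
  ContDiffOn ℝ k u Ω ∧
    ∀ K ⊆ Ω, IsCompact K → ∃ C : ℝ, ∀ x ∈ K, ∀ y ∈ K,
      ‖iteratedFDeriv ℝ k u x - iteratedFDeriv ℝ k u y‖ ≤ C * ‖x - y‖ ^ α

/-- The class `𝓛_{2σ}` of locally integrable functions `w` with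
`∫ |w(x)| / (1 + |x|^{n+2σ}) dx < ∞`. -/
def MemTailSpace {n : ℕ} (σ : ℝ) (w : En n → ℝ) : Prop :=
  LocallyIntegrable w ∧ Integrable (fun x : En n => |w x| / (1 + ‖x‖ ^ ((n : ℝ) + 2 * σ)))

/-- The normalizing constant `C_{n,σ} = 4^σ σ Γ(n/2+σ) / (π^{n/2} Γ(1-σ))`. -/
def fracLaplacianConst (n : ℕ) (σ : ℝ) : ℝ :=
  (4 : ℝ) ^ σ * σ * Real.Gamma ((n : ℝ) / 2 + σ) /
    (Real.pi ^ ((n : ℝ) / 2) * Real.Gamma (1 - σ))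

/-- `(-Δ)^σ w(x)` is defined as a principal value and equals `L`. -/
def HasFracLaplacianAt {n : ℕ} (σ : ℝ) (w : En n → ℝ) (x : En n) (L : ℝ) : Prop :=
  MemTailSpace σ w ∧
    Tendsto
      (fun δ : ℝ => fracLaplacianConst n σ *
        ∫ y in (Metric.ball x δ)ᶜ, (w x - w y) / ‖x - y‖ ^ ((n : ℝ) + 2 * σ))
      (𝓝[>] 0) (𝓝 L)

/-- The regularity class `C^{2s₀+[2s₁],{2s₁}+ε}_loc(Ω) ∩ C^{2s₀}(closure Ω)` for some `ε > 0`. -/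
def IsAdmissible {n : ℕ} (Ω : Set (En n)) (s₀ : ℕ) (s₁ : ℝ) (u : En n → ℝ) : Prop :=
  (∃ ε > 0, MemHolderLoc (2 * s₀ + ⌊2 * s₁⌋₊) (Int.fract (2 * s₁) + ε) Ω u) ∧
    ContDiffOn ℝ ((2 * s₀ : ℕ) : WithTop ℕ∞) u (closure Ω)

/-- `(u, v)` is a pair of positive classical solutions of `(-Δ)^{s₀+s₁} u = v^p`,
`(-Δ)^{t₀+t₁} v = u^q` in `Ω` with Navier exterior conditions, where
`(-Δ)^{s₀+s₁} = (-Δ)^{s₁} ∘ (-Δ)^{s₀}`. -/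
structure IsPositiveSolution {n : ℕ} (Ω : Set (En n)) (s₀ t₀ : ℕ) (s₁ t₁ p q : ℝ)
    (u v : En n → ℝ) : Prop where
  admissible_u : IsAdmissible Ω s₀ s₁ u
  admissible_v : IsAdmissible Ω t₀ t₁ v
  pos_u : ∀ x ∈ Ω, 0 < u x
  pos_v : ∀ x ∈ Ω, 0 < v x
  eq_u : ∀ x ∈ Ω, HasFracLaplacianAt s₁ (iterNegLaplacian Ω s₀ u) x (v x ^ p)
  eq_v : ∀ x ∈ Ω, HasFracLaplacianAt t₁ (iterNegLaplacian Ω t₀ v) x (u x ^ q)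
  navier_u : ∀ i ≤ s₀, ∀ x ∉ Ω, iterNegLaplacian Ω i u x = 0
  navier_v : ∀ j ≤ t₀, ∀ x ∉ Ω, iterNegLaplacian Ω j v x = 0

/-- The boundary layer `{x ∈ closure Ω | 0 ≤ (x - x₀) · ν ≤ δ}`. -/
def boundaryLayer {n : ℕ} (Ω : Set (En n)) (x₀ ν : En n) (δ : ℝ) : Set (En n) :=
  {x ∈ closure Ω | 0 ≤ inner ℝ (x - x₀) ν ∧ inner ℝ (x - x₀) ν ≤ δ}

/-- `f` is strictly increasing on `S` in the direction `ν`. -/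
def StrictlyIncreasingAlong {n : ℕ} (ν : En n) (S : Set (En n)) (f : En n → ℝ) : Prop :=
  ∀ x ∈ S, ∀ h : ℝ, 0 < h → x + h • ν ∈ S → f x < f (x + h • ν)

end

/-!
The proof is by moving planes. For `a ≥ 0` let `R` be the reflection in the hyperplane
`⟪x - x₀, ν⟫ = a` and let `D f = f ∘ R - f`. Strict convexity makes `x₀` an exposed point of
`closure Ω`, so the caps `{x ∈ closure Ω | ⟪x - x₀, ν⟫ ≤ a}` with `a ≤ δ₀` shrink to `x₀` and `R`
maps them into `Ω`; comparing `x` with `x + h ν` for `h > 0` amounts to showing `D f > 0` below the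
hyperplane.

The functions `(-Δ)^i u` solve the chain `-Δ ((-Δ)^i u) = (-Δ)^{i+1} u`, closed by the fractional
equation `(-Δ)^{s₁} ((-Δ)^{s₀} u) = v^p`. In a cap of height `l ≤ 1`, a lower bound `-M` for `D`
of the last function passes down to `D u` by the maximum principle for the Laplacian in a slab. At a
negative minimum `y` of the antisymmetric function `D ((-Δ)^{s₀} u)`, its `(-Δ)^{s₁}` is at most
`c l^{-2 s₁}` times its value at `y`, while `v^p` is Lipschitz in `v`; so for small `l` the bound
`-M` for the last functions of both chains improves to `-M / 2`, and `D ≥ 0` follows. Since only the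
part of the cap within distance `l` of the hyperplane needs this argument, and strict positivity is
open on the remaining compact part, the planes can be moved from `a = 0` to `a = δ₀`.
-/

/-! ### The Laplacian and the maximum principle in a slab -/

section SecondDerivative

variable {E : Type*} [NormedAddCommGroup E] [NormedSpace ℝ E]

theorem hasDerivAt_line (x e : E) (t : ℝ) : HasDerivAt (fun t : ℝ => x + t • e) e t := by
  simpa using ((hasDerivAt_id t).smul_const e).const_add x

theorem eventually_deriv_line {f : E → ℝ} {x : E} (hf : ContDiffAt ℝ 2 f x) (e : E) :
    ∀ᶠ t : ℝ in 𝓝 0, deriv (fun t : ℝ => f (x + t • e)) t = fderiv ℝ f (x + t • e) e := by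
  have hdiff : ∀ᶠ y in 𝓝 (x + (0 : ℝ) • e), DifferentiableAt ℝ f y := by
    rw [zero_smul, add_zero]
    exact (hf.eventually (by simp)).mono fun y hy => hy.differentiableAt (by norm_num)
  filter_upwards [(hasDerivAt_line x e 0).continuousAt.eventually hdiff] with t ht
  exact (ht.hasFDerivAt.comp_hasDerivAt t (hasDerivAt_line x e t)).deriv

theorem hasDerivAt_deriv_line {f : E → ℝ} {x : E} (hf : ContDiffAt ℝ 2 f x) (e : E) :
    HasDerivAt (deriv fun t : ℝ => f (x + t • e)) (iteratedFDeriv ℝ 2 f x ![e, e]) 0 := by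
  have hfderiv : ContDiffAt ℝ 1 (fderiv ℝ f) (x + (0 : ℝ) • e) := by
    simpa using hf.fderiv_right (m := 1) (by norm_num)
  have hcomp := (hfderiv.differentiableAt (by norm_num)).hasFDerivAt.comp_hasDerivAt (0 : ℝ)
    (hasDerivAt_line x e 0)
  have hsnd := hcomp.clm_apply (hasDerivAt_const (0 : ℝ) e)
  rw [iteratedFDeriv_two_apply]
  refine HasDerivAt.congr_of_eventuallyEq ?_ (eventually_deriv_line hf e)
  simpa using hsnd

theorem deriv_deriv_nonneg_of_isLocalMin {g : ℝ → ℝ} {a : ℝ} (h : IsLocalMin g a)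
    (hc : ContinuousAt g a) : 0 ≤ deriv (deriv g) a := by
  by_contra! hneg
  have hmax := isLocalMax_of_deriv_deriv_neg hneg h.deriv_eq_zero hc
  have hconst : g =ᶠ[𝓝 a] fun _ => g a := by
    filter_upwards [h, hmax] with t h1 h2 using le_antisymm h2 h1
  have hderiv : deriv g =ᶠ[𝓝 a] fun _ => 0 := by simpa using hconst.deriv
  exact hneg.ne (by simpa using hderiv.deriv_eq)

end SecondDerivative

section Laplacian

variable {E : Type*} [NormedAddCommGroup E] [InnerProductSpace ℝ E]

theorem contDiff_sq_inner_sub (ν : E) (c : ℝ) {k : WithTop ℕ∞} :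
    ContDiff ℝ k fun y : E => (inner ℝ y ν - c) ^ 2 :=
  ((contDiff_id.inner ℝ contDiff_const).sub contDiff_const).pow 2

variable [FiniteDimensional ℝ E]

theorem laplacian_eq_sum_deriv_deriv {ι : Type*} [Fintype ι] (b : OrthonormalBasis ι ℝ E)
    {f : E → ℝ} {x : E} (hf : ContDiffAt ℝ 2 f x) :
    Laplacian.laplacian f x = ∑ i, deriv (deriv fun t : ℝ => f (x + t • b i)) 0 := by
  rw [InnerProductSpace.laplacian_eq_iteratedFDeriv_orthonormalBasis f b]
  exact Finset.sum_congr rfl fun i _ => (hasDerivAt_deriv_line hf (b i)).deriv.symm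

theorem laplacian_nonneg_of_isLocalMin {f : E → ℝ} {x : E} (h : IsLocalMin f x)
    (hf : ContDiffAt ℝ 2 f x) : 0 ≤ Laplacian.laplacian f x := by
  rw [laplacian_eq_sum_deriv_deriv (stdOrthonormalBasis ℝ E) hf]
  refine Finset.sum_nonneg fun i _ => ?_
  set e := stdOrthonormalBasis ℝ E i
  have hline : Tendsto (fun t : ℝ => x + t • e) (𝓝 0) (𝓝 x) :=
    Continuous.tendsto' (by fun_prop) _ _ (by simp)
  have hmin : IsLocalMin (fun t : ℝ => f (x + t • e)) 0 := by
    simpa [IsLocalMin, IsMinFilter] using hline.eventually h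
  refine deriv_deriv_nonneg_of_isLocalMin hmin ?_
  simpa [ContinuousAt, Function.comp_def] using hf.continuousAt.tendsto.comp hline

theorem laplacian_comp_isometry_add {f : E → ℝ} (R : E ≃ₗᵢ[ℝ] E) (c : E) {x : E}
    (hf : ContDiffAt ℝ 2 f (R x + c)) :
    Laplacian.laplacian (fun y => f (R y + c)) x = Laplacian.laplacian f (R x + c) := by
  have hcomp : ContDiffAt ℝ 2 (fun y => f (R y + c)) x :=
    hf.comp x (R.contDiff.contDiffAt.add contDiffAt_const)
  rw [laplacian_eq_sum_deriv_deriv (stdOrthonormalBasis ℝ E) hcomp,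
    laplacian_eq_sum_deriv_deriv ((stdOrthonormalBasis ℝ E).map R) hf]
  simp only [map_add, map_smul, OrthonormalBasis.map_apply, add_right_comm]

theorem laplacian_sq_inner_sub (ν : E) (c : ℝ) (x : E) :
    Laplacian.laplacian (fun y : E => (inner ℝ y ν - c) ^ 2) x = 2 * ‖ν‖ ^ 2 := by
  rw [laplacian_eq_sum_deriv_deriv (stdOrthonormalBasis ℝ E)
    (contDiff_sq_inner_sub ν c).contDiffAt,
    ← (stdOrthonormalBasis ℝ E).sum_sq_norm_inner_right ν, Finset.mul_sum]
  refine Finset.sum_congr rfl fun i _ => ?_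
  set e : E := stdOrthonormalBasis ℝ E i
  have hline : ∀ t : ℝ, HasDerivAt (fun t : ℝ => inner ℝ (x + t • e) ν - c) (inner ℝ e ν) t := by
    intro t
    simp only [inner_add_left, real_inner_smul_left]
    simpa using (((hasDerivAt_id t).mul_const (inner ℝ e ν)).const_add (inner ℝ x ν)).sub_const c
  have hfst : deriv (fun t : ℝ => (inner ℝ (x + t • e) ν - c) ^ 2) =
      fun t => 2 * (inner ℝ (x + t • e) ν - c) * inner ℝ e ν :=
    funext fun t => by simpa using ((hline t).fun_pow 2).deriv
  rw [hfst, (((hline 0).const_mul 2).mul_const _).deriv, Real.norm_eq_abs, sq_abs]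
  ring

theorem contDiffOn_laplacianWithin {f : E → ℝ} {s : Set E} {m k : WithTop ℕ∞}
    (hf : ContDiffOn ℝ k f s) (hs : UniqueDiffOn ℝ s) (hmk : m + 2 ≤ k) :
    ContDiffOn ℝ m (InnerProductSpace.laplacianWithin f s) s := by
  have hsnd : ContDiffOn ℝ m (fderivWithin ℝ (fderivWithin ℝ f s) s) s :=
    (hf.fderivWithin hs (m := m + 1) (by rw [add_assoc]; exact_mod_cast hmk)).fderivWithin hs le_rfl
  have hsum : ContDiffOn ℝ m (fun x => ∑ i, fderivWithin ℝ (fderivWithin ℝ f s) s x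
      (stdOrthonormalBasis ℝ E i) (stdOrthonormalBasis ℝ E i)) s :=
    ContDiffOn.sum fun i _ => (hsnd.clm_apply contDiffOn_const).clm_apply contDiffOn_const
  refine hsum.congr fun x hx => ?_
  rw [InnerProductSpace.laplacianWithin_eq_iteratedFDerivWithin_stdOrthonormalBasis f hs hx]
  refine Finset.sum_congr rfl fun i _ => ?_
  simp [iteratedFDerivWithin_two_apply f hs hx]

theorem laplacianWithin_eq_laplacian_of_mem_interior {f : E → ℝ} {s : Set E} {x : E}
    (hs : UniqueDiffOn ℝ s) (hx : x ∈ interior s) :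
    InnerProductSpace.laplacianWithin f s x = Laplacian.laplacian f x := by
  rw [InnerProductSpace.laplacianWithin_eq_iteratedFDerivWithin_stdOrthonormalBasis f hs
    (interior_subset hx), InnerProductSpace.laplacian_eq_iteratedFDeriv_stdOrthonormalBasis,
    ← iteratedFDerivWithin_univ, iteratedFDerivWithin_congr_set
      (Filter.eventuallyEq_univ.mpr (mem_interior_iff_mem_nhds.mp hx))]

/-- Maximum principle in a slab, with the barrier `(M / 2) * (⟪x, ν⟫ - c) ^ 2`. -/
theorem neg_le_of_laplacian_le_of_slab {K : Set E} (hK : IsCompact K) {ν : E} (hν : ‖ν‖ = 1)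
    {c d : ℝ} (hslab : ∀ x ∈ K, |inner ℝ x ν - c| ≤ d) {U : E → ℝ} (hU : ContinuousOn U K)
    {M : ℝ} (hM : 0 ≤ M)
    (h : ∀ x ∈ K, U x < 0 → K ∈ 𝓝 x ∧ ContDiffAt ℝ 2 U x ∧ Laplacian.laplacian U x ≤ M) :
    ∀ x ∈ K, -(M / 2 * d ^ 2) ≤ U x := by
  intro x hx
  suffices hN : ∀ N > M, -(N / 2 * d ^ 2) ≤ U x by
    have hlim : Tendsto (fun N : ℝ => -(N / 2 * d ^ 2)) (𝓝[>] M) (𝓝 (-(M / 2 * d ^ 2))) :=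
      (Continuous.tendsto (by fun_prop) M).mono_left nhdsWithin_le_nhds
    exact le_of_tendsto hlim (eventually_mem_nhdsWithin.mono hN)
  intro N hN
  let q : E → ℝ := fun y => (inner ℝ y ν - c) ^ 2
  have hq : ContDiff ℝ 2 q := contDiff_sq_inner_sub ν c
  obtain ⟨y, hy, hmin⟩ := hK.exists_isMinOn ⟨x, hx⟩ (hU.sub (hq.continuous.continuousOn.const_smul
    (N / 2)))
  have hUy : 0 ≤ U y := by
    by_contra! hneg
    obtain ⟨hKy, hUc, hlap⟩ := h y hy hneg
    have hqc : ContDiffAt ℝ 2 ((N / 2) • q) y := contDiffAt_const.smul hq.contDiffAt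
    have hnonneg := laplacian_nonneg_of_isLocalMin (f := U - (N / 2) • q) (hmin.isLocalMin hKy)
      (hUc.sub hqc)
    rw [hUc.laplacian_sub hqc, InnerProductSpace.laplacian_smul _ hq.contDiffAt,
      laplacian_sq_inner_sub, hν, smul_eq_mul] at hnonneg
    linarith
  have hqy : q y ≤ d ^ 2 := sq_le_sq' (abs_le.mp (hslab y hy)).1 (abs_le.mp (hslab y hy)).2
  have hle : U y - N / 2 * q y ≤ U x - N / 2 * q x := hmin hx
  nlinarith [mul_le_mul_of_nonneg_left hqy (hM.trans hN.le), mul_nonneg (hM.trans hN.le)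
    (sq_nonneg (inner ℝ x ν - c))]

end Laplacian

/-! ### Reflection in a hyperplane -/

section HyperplaneReflection

variable {E : Type*} [NormedAddCommGroup E] [InnerProductSpace ℝ E]

/-- Reflection in the hyperplane `{x | ⟪x - x₀, ν⟫ = a}`, for a unit vector `ν`. -/
def hyperplaneReflection (x₀ ν : E) (a : ℝ) (x : E) : E :=
  x + (2 * (a - inner ℝ (x - x₀) ν)) • ν

/-- The half-space below the hyperplane `{x | ⟪x - x₀, ν⟫ = a}`. -/
def lowerHalfSpace (x₀ ν : E) (a : ℝ) : Set E := {x | inner ℝ (x - x₀) ν < a}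

/-- The comparison function of the moving plane method: `f` reflected in the hyperplane
`{x | ⟪x - x₀, ν⟫ = a}`, minus `f`. -/
def reflectionDiff (x₀ ν : E) (a : ℝ) (f : E → ℝ) (x : E) : ℝ :=
  f (hyperplaneReflection x₀ ν a x) - f x

/-- The part of `closure Ω` on or below the hyperplane `{x | ⟪x - x₀, ν⟫ = a}`. -/
def cap (Ω : Set E) (x₀ ν : E) (a : ℝ) : Set E := {x ∈ closure Ω | inner ℝ (x - x₀) ν ≤ a}

variable {Ω : Set E} {x₀ ν : E} {a : ℝ} {f : E → ℝ} {x y : E}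

theorem mem_lowerHalfSpace : x ∈ lowerHalfSpace x₀ ν a ↔ inner ℝ (x - x₀) ν < a := Iff.rfl

theorem isOpen_lowerHalfSpace : IsOpen (lowerHalfSpace x₀ ν a) :=
  isOpen_lt (by fun_prop) continuous_const

theorem isCompact_cap (hΩ : IsCompact (closure Ω)) : IsCompact (cap Ω x₀ ν a) :=
  hΩ.inter_right (t := {x : E | inner ℝ (x - x₀) ν ≤ a})
    (isClosed_le (by fun_prop) continuous_const)

theorem cap_mem_nhds (hΩ : IsOpen Ω) (hx : x ∈ Ω) (hxa : inner ℝ (x - x₀) ν < a) :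
    cap Ω x₀ ν a ∈ 𝓝 x :=
  Filter.mem_of_superset ((hΩ.inter isOpen_lowerHalfSpace).mem_nhds ⟨hx, hxa⟩) fun _ hy =>
    ⟨subset_closure hy.1, le_of_lt hy.2⟩

theorem contDiff_hyperplaneReflection {k : WithTop ℕ∞} :
    ContDiff ℝ k (hyperplaneReflection x₀ ν a) :=
  contDiff_id.add ((contDiff_const.mul (contDiff_const.sub
    ((contDiff_id.sub contDiff_const).inner ℝ contDiff_const))).smul contDiff_const)

theorem continuous_reflectionDiff_uncurry (hf : Continuous f) :
    Continuous fun z : ℝ × E => reflectionDiff x₀ ν z.1 f z.2 := by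
  unfold reflectionDiff hyperplaneReflection
  fun_prop

theorem continuous_reflectionDiff (hf : Continuous f) : Continuous (reflectionDiff x₀ ν a f) :=
  (hf.comp (contDiff_hyperplaneReflection (k := 0)).continuous).sub hf

theorem inner_sub_eq_inner_sub_sub_inner_sub (x₀ ν x y : E) :
    inner ℝ (x - y) ν = inner ℝ (x - x₀) ν - inner ℝ (y - x₀) ν := by
  rw [← inner_sub_left, sub_sub_sub_cancel_right]

theorem inner_hyperplaneReflection_sub (hν : ‖ν‖ = 1) (a : ℝ) (x : E) :
    inner ℝ (hyperplaneReflection x₀ ν a x - x₀) ν = 2 * a - inner ℝ (x - x₀) ν := by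
  rw [hyperplaneReflection, add_sub_right_comm, inner_add_left, real_inner_smul_left,
    real_inner_self_eq_norm_sq, hν]
  ring

theorem hyperplaneReflection_of_inner_eq (h : inner ℝ (x - x₀) ν = a) :
    hyperplaneReflection x₀ ν a x = x := by
  simp [hyperplaneReflection, h]

theorem hyperplaneReflection_eq_add_smul {h : ℝ} (ha : inner ℝ (x - x₀) ν = a - h / 2) :
    hyperplaneReflection x₀ ν a x = x + h • ν := by
  rw [hyperplaneReflection, ha]
  ring_nf

theorem hyperplaneReflection_hyperplaneReflection (hν : ‖ν‖ = 1) (a : ℝ) (x : E) :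
    hyperplaneReflection x₀ ν a (hyperplaneReflection x₀ ν a x) = x := by
  rw [hyperplaneReflection, inner_hyperplaneReflection_sub hν, hyperplaneReflection]
  module

theorem reflectionDiff_hyperplaneReflection (hν : ‖ν‖ = 1) (x : E) :
    reflectionDiff x₀ ν a f (hyperplaneReflection x₀ ν a x) = -reflectionDiff x₀ ν a f x := by
  rw [reflectionDiff, hyperplaneReflection_hyperplaneReflection hν, reflectionDiff, neg_sub]

theorem reflectionDiff_of_inner_eq (h : inner ℝ (x - x₀) ν = a) :
    reflectionDiff x₀ ν a f x = 0 := by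
  rw [reflectionDiff, hyperplaneReflection_of_inner_eq h, sub_self]

theorem isClosed_setOf_reflectionDiff_nonneg (hf : Continuous f) :
    IsClosed {a : ℝ | ∀ x ∈ cap Ω x₀ ν a, 0 ≤ reflectionDiff x₀ ν a f x} := by
  have hset : {a : ℝ | ∀ x ∈ cap Ω x₀ ν a, 0 ≤ reflectionDiff x₀ ν a f x} =
      ⋂ x ∈ closure Ω, {a : ℝ | a ≤ inner ℝ (x - x₀) ν} ∪
        {a : ℝ | 0 ≤ reflectionDiff x₀ ν a f x} := by
    ext a
    simp only [mem_ofPred_eq, mem_iInter₂, mem_union]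
    refine ⟨fun h x hx => ?_, fun h x hx => (h x hx.1).elim (fun hax => ?_) id⟩
    · exact (le_total a (inner ℝ (x - x₀) ν)).imp_right fun hxa => h x ⟨hx, hxa⟩
    · exact (reflectionDiff_of_inner_eq (le_antisymm hx.2 hax)).ge
  rw [hset]
  exact isClosed_biInter fun x _ => (isClosed_le continuous_id continuous_const).union
    (isClosed_le continuous_const
      ((continuous_reflectionDiff_uncurry hf).comp (Continuous.prodMk_left x)))

theorem eventually_forall_cap_reflectionDiff_pos (hΩ : IsCompact (closure Ω)) (hf : Continuous f)
    {b : ℝ} (hpos : ∀ x ∈ cap Ω x₀ ν b, 0 < reflectionDiff x₀ ν a f x) :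
    ∀ᶠ a' in 𝓝 a, ∀ x ∈ cap Ω x₀ ν b, 0 < reflectionDiff x₀ ν a' f x :=
  (isCompact_cap hΩ).eventually_forall_of_forall_eventually fun x hx =>
    ((continuous_reflectionDiff_uncurry hf).tendsto (a, x)).eventually (lt_mem_nhds (hpos x hx))

theorem hyperplaneReflection_eq_reflection_add (hν : ‖ν‖ = 1) (a : ℝ) (x : E) :
    hyperplaneReflection x₀ ν a x =
      (Submodule.span ℝ {ν})ᗮ.reflection x + (2 * (a + inner ℝ x₀ ν)) • ν := by
  rw [Submodule.reflection_orthogonal_apply, Submodule.reflection_singleton_apply, hν,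
    hyperplaneReflection, inner_sub_left, real_inner_comm x ν]
  simp only [RCLike.ofReal_one, one_pow, div_one]
  module

theorem norm_hyperplaneReflection_sub (hν : ‖ν‖ = 1) (a : ℝ) (x y : E) :
    ‖hyperplaneReflection x₀ ν a x - hyperplaneReflection x₀ ν a y‖ = ‖x - y‖ := by
  rw [hyperplaneReflection_eq_reflection_add hν, hyperplaneReflection_eq_reflection_add hν,
    add_sub_add_right_eq_sub, ← map_sub, LinearIsometryEquiv.norm_map]

theorem norm_sub_hyperplaneReflection_sq (hν : ‖ν‖ = 1) (a : ℝ) (x y : E) :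
    ‖x - hyperplaneReflection x₀ ν a y‖ ^ 2 =
      ‖x - y‖ ^ 2 + 4 * (a - inner ℝ (x - x₀) ν) * (a - inner ℝ (y - x₀) ν) := by
  rw [hyperplaneReflection, ← sub_sub, norm_sub_sq_real, real_inner_smul_right, norm_smul, hν,
    inner_sub_eq_inner_sub_sub_inner_sub x₀ ν x y, mul_one, Real.norm_eq_abs, sq_abs]
  ring

theorem norm_sub_lt_norm_sub_hyperplaneReflection (hν : ‖ν‖ = 1)
    (hx : x ∈ lowerHalfSpace x₀ ν a) (hy : y ∈ lowerHalfSpace x₀ ν a) :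
    ‖x - y‖ < ‖x - hyperplaneReflection x₀ ν a y‖ := by
  refine lt_of_pow_lt_pow_left₀ 2 (norm_nonneg _) ?_
  rw [norm_sub_hyperplaneReflection_sq hν]
  linarith [mul_pos (sub_pos.mpr (mem_lowerHalfSpace.mp hx))
    (sub_pos.mpr (mem_lowerHalfSpace.mp hy))]

theorem ball_sub_inner_subset_lowerHalfSpace (hν : ‖ν‖ = 1) :
    Metric.ball x (a - inner ℝ (x - x₀) ν) ⊆ lowerHalfSpace x₀ ν a := by
  intro y hy
  have h := real_inner_le_norm (y - x) ν
  rw [hν, mul_one, inner_sub_eq_inner_sub_sub_inner_sub x₀] at h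
  rw [mem_ball_iff_norm] at hy
  rw [mem_lowerHalfSpace]
  linarith

theorem laplacian_reflectionDiff [FiniteDimensional ℝ E] (hν : ‖ν‖ = 1)
    (hRx : ContDiffAt ℝ 2 f (hyperplaneReflection x₀ ν a x)) (hx : ContDiffAt ℝ 2 f x) :
    Laplacian.laplacian (reflectionDiff x₀ ν a f) x =
      Laplacian.laplacian f (hyperplaneReflection x₀ ν a x) - Laplacian.laplacian f x := by
  have hcomp : ContDiffAt ℝ 2 (fun y => f (hyperplaneReflection x₀ ν a y)) x :=
    hRx.comp x contDiff_hyperplaneReflection.contDiffAt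
  have hR := funext (hyperplaneReflection_eq_reflection_add (x₀ := x₀) hν a)
  have hlap : Laplacian.laplacian (fun y => f (hyperplaneReflection x₀ ν a y)) x =
      Laplacian.laplacian f (hyperplaneReflection x₀ ν a x) := by
    simp only [hR] at hRx ⊢
    exact laplacian_comp_isometry_add _ _ hRx
  rw [← hlap]
  exact hcomp.laplacian_sub hx

section Measure

variable [MeasurableSpace E] [BorelSpace E]

theorem measurableEmbedding_hyperplaneReflection (hν : ‖ν‖ = 1) :
    MeasurableEmbedding (hyperplaneReflection x₀ ν a) :=
  (Homeomorph.mk ⟨hyperplaneReflection x₀ ν a, hyperplaneReflection x₀ ν a,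
    hyperplaneReflection_hyperplaneReflection hν a, hyperplaneReflection_hyperplaneReflection hν a⟩
    (contDiff_hyperplaneReflection (k := 0)).continuous
    (contDiff_hyperplaneReflection (k := 0)).continuous).measurableEmbedding

variable [FiniteDimensional ℝ E]

theorem measurePreserving_hyperplaneReflection (hν : ‖ν‖ = 1) :
    MeasurePreserving (hyperplaneReflection x₀ ν a) (volume : Measure E) volume := by
  rw [funext (hyperplaneReflection_eq_reflection_add hν a)]
  exact (measurePreserving_add_right volume _).comp (LinearIsometryEquiv.measurePreserving _)

theorem volume_hyperplane (hν : ν ≠ 0) (x₀ : E) (a : ℝ) :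
    volume {x : E | inner ℝ (x - x₀) ν = a} = 0 := by
  by_cases hne : ∃ p : E, inner ℝ (p - x₀) ν = a
  · obtain ⟨p, hp⟩ := hne
    have hset : {x : E | inner ℝ (x - x₀) ν = a} =
        (AffineSubspace.mk' p (Submodule.span ℝ {ν})ᗮ : Set E) := by
      ext x
      rw [SetLike.mem_coe, AffineSubspace.mem_mk', vsub_eq_sub,
        Submodule.mem_orthogonal_singleton_iff_inner_left,
        inner_sub_eq_inner_sub_sub_inner_sub x₀, hp, sub_eq_zero, mem_ofPred_eq]
    rw [hset]
    refine Measure.addHaar_affineSubspace _ _ fun htop => hν ?_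
    have hmem : ν +ᵥ p ∈ AffineSubspace.mk' p (Submodule.span ℝ {ν})ᗮ := htop ▸ trivial
    rwa [AffineSubspace.mem_mk', vadd_vsub, Submodule.mem_orthogonal_singleton_iff_inner_left,
      inner_self_eq_zero] at hmem
  · have hset : {x : E | inner ℝ (x - x₀) ν = a} = ∅ :=
      eq_empty_of_forall_notMem fun x hx => hne ⟨x, hx⟩
    rw [hset, measure_empty]

theorem preimage_compl_lowerHalfSpace_ae_eq (hν : ‖ν‖ = 1) :
    hyperplaneReflection x₀ ν a ⁻¹' (lowerHalfSpace x₀ ν a)ᶜ =ᵐ[volume] lowerHalfSpace x₀ ν a := by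
  have hν0 : ν ≠ 0 := norm_ne_zero_iff.mp (hν.symm ▸ one_ne_zero)
  have hoff : ∀ᵐ x : E, inner ℝ (x - x₀) ν ≠ a := by
    simpa [ae_iff] using volume_hyperplane hν0 x₀ a
  filter_upwards [hoff] with x hx
  refine propext (?_ : x ∈ hyperplaneReflection x₀ ν a ⁻¹' (lowerHalfSpace x₀ ν a)ᶜ ↔
    x ∈ lowerHalfSpace x₀ ν a)
  rw [mem_preimage, mem_compl_iff, mem_lowerHalfSpace, mem_lowerHalfSpace,
    inner_hyperplaneReflection_sub hν, not_lt]
  exact ⟨fun h => lt_of_le_of_ne (by linarith) hx, fun h => by linarith⟩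

theorem setIntegral_compl_lowerHalfSpace (hν : ‖ν‖ = 1) (g : E → ℝ) :
    ∫ y in (lowerHalfSpace x₀ ν a)ᶜ, g y =
      ∫ y in lowerHalfSpace x₀ ν a, g (hyperplaneReflection x₀ ν a y) := by
  rw [← (measurePreserving_hyperplaneReflection hν).setIntegral_preimage_emb
    (measurableEmbedding_hyperplaneReflection hν),
    setIntegral_congr_set (preimage_compl_lowerHalfSpace_ae_eq hν)]

theorem integrableOn_comp_hyperplaneReflection (hν : ‖ν‖ = 1) {g : E → ℝ}
    (hg : IntegrableOn g (lowerHalfSpace x₀ ν a)ᶜ) :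
    IntegrableOn (fun y => g (hyperplaneReflection x₀ ν a y)) (lowerHalfSpace x₀ ν a) :=
  (((measurePreserving_hyperplaneReflection hν).integrableOn_comp_preimage
    (measurableEmbedding_hyperplaneReflection hν)).mpr hg).congr_set_ae
    (preimage_compl_lowerHalfSpace_ae_eq hν).symm

end Measure

end HyperplaneReflection

/-! ### The fractional Laplacian of antisymmetric functions -/

section FractionalLaplacian

variable {n : ℕ} {σ : ℝ}

theorem fracLaplacianConst_pos (hσ : σ ∈ Ioo (0 : ℝ) 1) : 0 < fracLaplacianConst n σ := by
  have hσ0 : 0 < σ := hσ.1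
  have hσ1 : 0 < 1 - σ := sub_pos.mpr hσ.2
  unfold fracLaplacianConst
  positivity

/-- The kernel `|x - y|^{-(n+2σ)}` of the fractional Laplacian. -/
noncomputable def fracKernel {n : ℕ} (σ : ℝ) (x y : En n) : ℝ := (‖x - y‖ ^ ((n : ℝ) + 2 * σ))⁻¹

theorem fracKernel_nonneg (x y : En n) : 0 ≤ fracKernel σ x y := by
  unfold fracKernel
  positivity

theorem measurable_fracKernel (x : En n) : Measurable (fracKernel σ x) := by
  unfold fracKernel
  fun_prop

theorem inv_rpow_le_fracKernel (hσ : 0 < σ) {x y : En n} {r : ℝ} (hxy : 0 < ‖x - y‖)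
    (hr : ‖x - y‖ ≤ r) : (r ^ ((n : ℝ) + 2 * σ))⁻¹ ≤ fracKernel σ x y :=
  inv_anti₀ (by positivity) (Real.rpow_le_rpow hxy.le hr (by positivity))

theorem fracKernel_hyperplaneReflection_lt (hσ : 0 < σ) {x₀ ν : En n} (hν : ‖ν‖ = 1) {a : ℝ}
    {x y : En n} (hx : x ∈ lowerHalfSpace x₀ ν a) (hy : y ∈ lowerHalfSpace x₀ ν a) (hxy : x ≠ y) :
    fracKernel σ x (hyperplaneReflection x₀ ν a y) < fracKernel σ x y := by
  have hpos : 0 < ‖x - y‖ := norm_sub_pos_iff.mpr hxy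
  exact inv_strictAnti₀ (by positivity) (Real.rpow_lt_rpow hpos.le
    (norm_sub_lt_norm_sub_hyperplaneReflection hν hx hy) (by positivity))

theorem HasFracLaplacianAt.tendsto_fracKernel {w : En n → ℝ} {x : En n} {L : ℝ}
    (h : HasFracLaplacianAt σ w x L) :
    Tendsto (fun δ : ℝ => fracLaplacianConst n σ *
      ∫ y in (Metric.ball x δ)ᶜ, (w x - w y) * fracKernel σ x y) (𝓝[>] 0) (𝓝 L) := by
  simpa only [fracKernel, div_eq_mul_inv] using h.2

theorem HasFracLaplacianAt.nonpos_of_forall_le {w : En n → ℝ} {x : En n} {L : ℝ}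
    (hσ : σ ∈ Ioo (0 : ℝ) 1) (h : HasFracLaplacianAt σ w x L) (hmin : ∀ y, w x ≤ w y) : L ≤ 0 :=
  le_of_tendsto h.tendsto_fracKernel (Eventually.of_forall fun _ =>
    mul_nonpos_of_nonneg_of_nonpos (fracLaplacianConst_pos hσ).le (integral_nonpos fun y =>
      mul_nonpos_of_nonpos_of_nonneg (sub_nonpos.mpr (hmin y)) (fracKernel_nonneg x y)))

theorem integrable_inv_one_add_norm_rpow {E : Type*} [NormedAddCommGroup E] [NormedSpace ℝ E]
    [FiniteDimensional ℝ E] [MeasurableSpace E] [BorelSpace E] (μ : Measure E) [μ.IsAddHaarMeasure]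
    {α : ℝ} (hα : (Module.finrank ℝ E : ℝ) < α) : Integrable (fun y : E => (1 + ‖y‖ ^ α)⁻¹) μ := by
  have hα0 : 0 ≤ α := (Nat.cast_nonneg _).trans hα.le
  refine ((integrable_one_add_norm (μ := μ) hα).const_mul (2 ^ α)).mono'
    (Measurable.aestronglyMeasurable (by fun_prop)) (Eventually.of_forall fun y => ?_)
  have hmax : (max 1 ‖y‖) ^ α ≤ 1 + ‖y‖ ^ α := by
    rcases max_cases 1 ‖y‖ with ⟨h, -⟩ | ⟨h, -⟩ <;> rw [h]
    · simpa using Real.rpow_nonneg (norm_nonneg y) α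
    · linarith
  have hsum : (1 + ‖y‖) ^ α ≤ 2 ^ α * (1 + ‖y‖ ^ α) :=
    calc (1 + ‖y‖) ^ α ≤ (2 * max 1 ‖y‖) ^ α :=
          Real.rpow_le_rpow (by positivity)
            (by linarith [le_max_left 1 ‖y‖, le_max_right 1 ‖y‖]) hα0
      _ = 2 ^ α * (max 1 ‖y‖) ^ α := Real.mul_rpow two_pos.le (by positivity)
      _ ≤ 2 ^ α * (1 + ‖y‖ ^ α) := by gcongr
  rw [Real.norm_of_nonneg (by positivity), Real.rpow_neg (by positivity), ← div_eq_mul_inv,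
    inv_le_comm₀ (by positivity) (by positivity), inv_div]
  exact (div_le_iff₀' (by positivity)).mpr hsum

theorem memTailSpace_of_bounded (hσ : 0 < σ) {w : En n → ℝ} (hw : Continuous w) {B : ℝ}
    (hB : ∀ y, |w y| ≤ B) : MemTailSpace σ w := by
  refine ⟨hw.locallyIntegrable, ?_⟩
  have hweight := integrable_inv_one_add_norm_rpow (volume : Measure (En n))
    (α := (n : ℝ) + 2 * σ) (by rw [finrank_euclideanSpace_fin]; linarith)
  simp only [div_eq_mul_inv]
  exact hweight.bdd_mul hw.abs.aestronglyMeasurable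
    (Eventually.of_forall fun y => by rw [Real.norm_eq_abs, abs_abs]; exact hB y)

theorem MemTailSpace.sub {v w : En n → ℝ} (hv : MemTailSpace σ v) (hw : MemTailSpace σ w) :
    MemTailSpace σ fun y => v y - w y := by
  refine ⟨hv.1.sub hw.1, (hv.2.add hw.2).mono' ?_ (Eventually.of_forall fun y => ?_)⟩
  · simp only [div_eq_mul_inv]
    exact (hv.1.sub hw.1).aestronglyMeasurable.norm.mul
      (Measurable.aestronglyMeasurable (by fun_prop))
  · rw [Real.norm_of_nonneg (by positivity), Pi.add_apply, ← add_div]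
    exact div_le_div_of_nonneg_right (abs_sub (v y) (w y)) (by positivity)

theorem MemTailSpace.const_sub (hσ : 0 < σ) {w : En n → ℝ} (hw : MemTailSpace σ w) (c : ℝ) :
    MemTailSpace σ fun y => c - w y :=
  (memTailSpace_of_bounded hσ continuous_const fun _ => le_rfl).sub hw

theorem MemTailSpace.integrableOn_mul_fracKernel (hσ : 0 < σ) {w : En n → ℝ}
    (hw : MemTailSpace σ w) (x : En n) {δ : ℝ} (hδ : 0 < δ) :
    IntegrableOn (fun y => w y * fracKernel σ x y) (Metric.ball x δ)ᶜ := by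
  set α : ℝ := (n : ℝ) + 2 * σ with hα
  have hα0 : 0 ≤ α := by positivity
  refine ((hw.2.const_mul ((1 / δ) ^ α + (‖x‖ / δ + 1) ^ α)).integrableOn).mono'
    (hw.1.aestronglyMeasurable.mul (measurable_fracKernel x).aestronglyMeasurable).restrict
    ((ae_restrict_iff' Metric.isOpen_ball.measurableSet.compl).mpr
      (Eventually.of_forall fun y hy => ?_))
  have hyδ : δ ≤ ‖x - y‖ := by
    rwa [mem_compl_iff, mem_ball_iff_norm', not_lt] at hy
  have hpos : 0 < ‖x - y‖ := hδ.trans_le hyδ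
  have hone : 1 ≤ 1 / δ * ‖x - y‖ := by rwa [one_div_mul_eq_div, one_le_div hδ]
  have hnorm : ‖y‖ ≤ (‖x‖ / δ + 1) * ‖x - y‖ := by
    have htri : ‖y‖ ≤ ‖x‖ + ‖x - y‖ := by simpa using norm_sub_le x (x - y)
    have hx : ‖x‖ ≤ ‖x‖ * (1 / δ * ‖x - y‖) := le_mul_of_one_le_right (norm_nonneg x) hone
    calc ‖y‖ ≤ ‖x‖ * (1 / δ * ‖x - y‖) + ‖x - y‖ := by linarith
      _ = (‖x‖ / δ + 1) * ‖x - y‖ := by ring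
  have hweight : 1 + ‖y‖ ^ α ≤ ((1 / δ) ^ α + (‖x‖ / δ + 1) ^ α) * ‖x - y‖ ^ α := by
    rw [add_mul, ← Real.mul_rpow (by positivity) hpos.le, ← Real.mul_rpow (by positivity) hpos.le]
    exact add_le_add (Real.one_le_rpow hone hα0) (Real.rpow_le_rpow (norm_nonneg y) hnorm hα0)
  rw [norm_mul, Real.norm_of_nonneg (fracKernel_nonneg x y), Real.norm_eq_abs, fracKernel, ← hα,
    mul_div_left_comm]
  refine mul_le_mul_of_nonneg_left ?_ (abs_nonneg _)
  rwa [le_div_iff₀ (by positivity), inv_mul_le_iff₀ (by positivity), mul_comm]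

variable {x₀ ν : En n}

theorem HasFracLaplacianAt.reflection_sub (hσ : 0 < σ) (hν : ‖ν‖ = 1) {a : ℝ} {w : En n → ℝ}
    (hw : Continuous w) {B : ℝ} (hB : ∀ y, |w y| ≤ B) {x : En n} {L₁ L₂ : ℝ}
    (h₁ : HasFracLaplacianAt σ w x L₁)
    (h₂ : HasFracLaplacianAt σ w (hyperplaneReflection x₀ ν a x) L₂) :
    HasFracLaplacianAt σ (reflectionDiff x₀ ν a w) x (L₂ - L₁) := by
  set R := hyperplaneReflection x₀ ν a with hR
  have hwR : MemTailSpace σ fun y => w (R y) :=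
    memTailSpace_of_bounded hσ (hw.comp (contDiff_hyperplaneReflection (k := 0)).continuous)
      fun y => hB (R y)
  refine ⟨hwR.sub h₁.1, (h₂.tendsto_fracKernel.sub h₁.tendsto_fracKernel).congr' ?_⟩
  filter_upwards [self_mem_nhdsWithin] with δ (hδ : 0 < δ)
  have hpre : R ⁻¹' (Metric.ball (R x) δ)ᶜ = (Metric.ball x δ)ᶜ := by
    ext y
    simp only [mem_preimage, mem_compl_iff, mem_ball_iff_norm, hR, norm_hyperplaneReflection_sub hν]
  have hchange : ∫ y in (Metric.ball (R x) δ)ᶜ, (w (R x) - w y) * fracKernel σ (R x) y =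
      ∫ y in (Metric.ball x δ)ᶜ, (w (R x) - w (R y)) * fracKernel σ x y := by
    rw [← (measurePreserving_hyperplaneReflection hν).setIntegral_preimage_emb
      (measurableEmbedding_hyperplaneReflection hν), hpre]
    simp only [fracKernel, hR, norm_hyperplaneReflection_sub hν]
  rw [hchange, ← mul_sub, ← integral_sub
    ((hwR.const_sub hσ (w (R x))).integrableOn_mul_fracKernel hσ x hδ)
    ((h₁.1.const_sub hσ (w x)).integrableOn_mul_fracKernel hσ x hδ)]
  simp only [reflectionDiff, ← hR, div_eq_mul_inv, fracKernel]
  congr 2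
  funext y
  ring

end FractionalLaplacian

/-! ### The narrow region principle -/

theorem tendsto_setIntegral_diff_ball {X : Type*} [MetricSpace X] [MeasurableSpace X]
    [OpensMeasurableSpace X] {μ : Measure X} [NullSingletonClass μ] {S : Set X} {g : X → ℝ}
    (hg : IntegrableOn g S μ) (x : X) :
    Tendsto (fun δ => ∫ y in S \ Metric.ball x δ, g y ∂μ) (𝓝[>] 0) (𝓝 (∫ y in S, g y ∂μ)) := by
  have hcover : AECover (μ.restrict S) (𝓝[>] (0 : ℝ)) fun δ => (Metric.ball x δ)ᶜ :=
    { ae_eventually_mem := by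
        filter_upwards [Measure.ae_ne (μ.restrict S) x] with y hy
        have hpos : 0 < dist y x := dist_pos.mpr hy
        filter_upwards [Ioo_mem_nhdsGT hpos] with δ hδ
        exact not_lt.mpr hδ.2.le
      measurableSet := fun _ => Metric.isOpen_ball.measurableSet.compl }
  have h := hcover.integral_tendsto_of_countably_generated hg
  simp only [Measure.restrict_restrict Metric.isOpen_ball.measurableSet.compl] at h
  simpa only [sdiff_eq, inter_comm] using h

section Antisymmetric

variable {n : ℕ} {σ a : ℝ} {x₀ ν x : En n} {U : En n → ℝ}

/-- The kernel of the fractional Laplacian on functions that are antisymmetric about a hyperplane,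
folded onto the half-space below that hyperplane. -/
noncomputable def foldedFracKernel (σ : ℝ) (x₀ ν : En n) (a : ℝ) (x y : En n) : ℝ :=
  fracKernel σ x y - fracKernel σ x (hyperplaneReflection x₀ ν a y)

theorem compl_lowerHalfSpace_subset_compl_ball (hν : ‖ν‖ = 1) :
    (lowerHalfSpace x₀ ν a)ᶜ ⊆ (Metric.ball x (a - inner ℝ (x - x₀) ν))ᶜ :=
  compl_subset_compl.mpr (ball_sub_inner_subset_lowerHalfSpace hν)

theorem foldedFracKernel_pos (hσ : 0 < σ) (hν : ‖ν‖ = 1) {y : En n}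
    (hx : x ∈ lowerHalfSpace x₀ ν a) (hy : y ∈ lowerHalfSpace x₀ ν a) (hxy : x ≠ y) :
    0 < foldedFracKernel σ x₀ ν a x y :=
  sub_pos.mpr (fracKernel_hyperplaneReflection_lt hσ hν hx hy hxy)

theorem MemTailSpace.integrableOn_mul_fracKernel_compl (hσ : 0 < σ) (hν : ‖ν‖ = 1)
    {w : En n → ℝ} (hw : MemTailSpace σ w) (hx : x ∈ lowerHalfSpace x₀ ν a) :
    IntegrableOn (fun y => w y * fracKernel σ x y) (lowerHalfSpace x₀ ν a)ᶜ :=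
  (hw.integrableOn_mul_fracKernel hσ x (sub_pos.mpr (mem_lowerHalfSpace.mp hx))).mono_set
    (compl_lowerHalfSpace_subset_compl_ball hν)

theorem integrableOn_fracKernel_compl (hσ : 0 < σ) (hν : ‖ν‖ = 1)
    (hx : x ∈ lowerHalfSpace x₀ ν a) :
    IntegrableOn (fracKernel σ x) (lowerHalfSpace x₀ ν a)ᶜ := by
  simpa only [one_mul] using
    (memTailSpace_of_bounded hσ (continuous_const (y := (1 : ℝ)))
      fun _ => le_rfl).integrableOn_mul_fracKernel_compl hσ hν hx

section

variable (hσ : 0 < σ) (hν : ‖ν‖ = 1) (hU : MemTailSpace σ U)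
  (hanti : ∀ y, U (hyperplaneReflection x₀ ν a y) = -U y) (hx : x ∈ lowerHalfSpace x₀ ν a)

include hσ hν hU hanti hx

theorem integrableOn_sub_mul_fracKernel_reflection :
    IntegrableOn (fun y => (U y - U x) * fracKernel σ x (hyperplaneReflection x₀ ν a y))
      (lowerHalfSpace x₀ ν a) := by
  have h := (((hU.const_sub hσ (U x)).integrableOn_mul_fracKernel_compl hσ hν hx).sub
    ((integrableOn_fracKernel_compl hσ hν hx).const_mul (2 * U x)))
  refine (integrableOn_comp_hyperplaneReflection hν h).congr (Eventually.of_forall fun y => ?_)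
  simp only [Pi.sub_apply, hanti]
  ring

theorem integrableOn_sub_mul_foldedFracKernel {δ : ℝ} (hδ : 0 < δ) :
    IntegrableOn (fun y => (U y - U x) * foldedFracKernel σ x₀ ν a x y)
      (lowerHalfSpace x₀ ν a \ Metric.ball x δ) := by
  have h := ((hU.const_sub hσ (U x)).integrableOn_mul_fracKernel hσ x hδ).mono_set
    (s := lowerHalfSpace x₀ ν a \ Metric.ball x δ) fun _ hy => hy.2
  refine (h.neg.sub ((integrableOn_sub_mul_fracKernel_reflection hσ hν hU hanti hx).mono_set
    sdiff_subset)).congr (Eventually.of_forall fun y => ?_)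
  simp only [foldedFracKernel, Pi.sub_apply, Pi.neg_apply]
  ring

theorem setIntegral_compl_lowerHalfSpace_sub_mul_fracKernel :
    ∫ y in (lowerHalfSpace x₀ ν a)ᶜ, (U x - U y) * fracKernel σ x y =
      2 * U x * (∫ y in (lowerHalfSpace x₀ ν a)ᶜ, fracKernel σ x y) +
        ∫ y in lowerHalfSpace x₀ ν a,
          (U y - U x) * fracKernel σ x (hyperplaneReflection x₀ ν a y) := by
  have hk := integrableOn_comp_hyperplaneReflection hν (integrableOn_fracKernel_compl hσ hν hx)
  rw [setIntegral_compl_lowerHalfSpace hν, setIntegral_compl_lowerHalfSpace hν,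
    ← integral_const_mul, ← integral_add (hk.const_mul _)
      (integrableOn_sub_mul_fracKernel_reflection hσ hν hU hanti hx)]
  refine integral_congr_ae (Eventually.of_forall fun y => ?_)
  simp only [hanti]
  ring

theorem setIntegral_compl_ball_eq_fold {δ : ℝ} (hδ : 0 < δ)
    (hball : Metric.ball x δ ⊆ lowerHalfSpace x₀ ν a) :
    ∫ y in (Metric.ball x δ)ᶜ, (U x - U y) * fracKernel σ x y =
      2 * U x * (∫ y in (lowerHalfSpace x₀ ν a)ᶜ, fracKernel σ x y) -
        (∫ y in lowerHalfSpace x₀ ν a \ Metric.ball x δ,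
          (U y - U x) * foldedFracKernel σ x₀ ν a x y) +
        ((∫ y in lowerHalfSpace x₀ ν a,
            (U y - U x) * fracKernel σ x (hyperplaneReflection x₀ ν a y)) -
          ∫ y in lowerHalfSpace x₀ ν a \ Metric.ball x δ,
            (U y - U x) * fracKernel σ x (hyperplaneReflection x₀ ν a y)) := by
  set S := lowerHalfSpace x₀ ν a
  have hsplit : (Metric.ball x δ)ᶜ = S \ Metric.ball x δ ∪ Sᶜ := by
    ext y
    by_cases hy : y ∈ S
    · simp [hy]
    · simpa [hy] using mt (@hball y) hy
  have hout := (hU.const_sub hσ (U x)).integrableOn_mul_fracKernel hσ x hδ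
  have hnear : ∫ y in S \ Metric.ball x δ, (U x - U y) * fracKernel σ x y =
      -(∫ y in S \ Metric.ball x δ, (U y - U x) * foldedFracKernel σ x₀ ν a x y) -
        ∫ y in S \ Metric.ball x δ,
          (U y - U x) * fracKernel σ x (hyperplaneReflection x₀ ν a y) := by
    have hfold := (integrableOn_sub_mul_foldedFracKernel hσ hν hU hanti hx hδ).neg
    rw [← integral_neg, ← integral_sub (by exact hfold)
      ((integrableOn_sub_mul_fracKernel_reflection hσ hν hU hanti hx).mono_set sdiff_subset)]
    refine integral_congr_ae (Eventually.of_forall fun y => ?_)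
    simp only [foldedFracKernel]
    ring
  rw [hsplit, setIntegral_union (disjoint_compl_right.mono_left sdiff_subset)
    isOpen_lowerHalfSpace.measurableSet.compl (hout.mono_set fun _ hy => hy.2)
    (hout.mono_set (compl_subset_compl.mpr hball)), hnear,
    setIntegral_compl_lowerHalfSpace_sub_mul_fracKernel hσ hν hU hanti hx]
  ring

end

variable {L : ℝ}

-- Folding about the hyperplane leaves a nonnegative integrand, of which any part may be discarded.
theorem HasFracLaplacianAt.le_of_forall_le (hσ : σ ∈ Ioo (0 : ℝ) 1) (hν : ‖ν‖ = 1)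
    (h : HasFracLaplacianAt σ U x L) (hanti : ∀ y, U (hyperplaneReflection x₀ ν a y) = -U y)
    (hx : x ∈ lowerHalfSpace x₀ ν a) (hmin : ∀ y ∈ lowerHalfSpace x₀ ν a, U x ≤ U y)
    {A : Set (En n)} {r : ℝ} (hr : 0 < r) (hA : A ⊆ lowerHalfSpace x₀ ν a \ Metric.ball x r) :
    L ≤ fracLaplacianConst n σ *
      (2 * U x * (∫ y in (lowerHalfSpace x₀ ν a)ᶜ, fracKernel σ x y) -
        ∫ y in A, (U y - U x) * foldedFracKernel σ x₀ ν a x y) := by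
  set S := lowerHalfSpace x₀ ν a
  have hSm : MeasurableSet S := isOpen_lowerHalfSpace.measurableSet
  have : Nontrivial (En n) := ⟨ν, 0, norm_ne_zero_iff.mp (hν.symm ▸ one_ne_zero)⟩
  have hrefl := integrableOn_sub_mul_fracKernel_reflection hσ.1 hν h.1 hanti hx
  have herr := (tendsto_const_nhds (x := ∫ y in S,
    (U y - U x) * fracKernel σ x (hyperplaneReflection x₀ ν a y))).sub
      (tendsto_setIntegral_diff_ball hrefl x)
  have hright := ((tendsto_const_nhds (x := 2 * U x * (∫ y in Sᶜ, fracKernel σ x y) -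
    ∫ y in A, (U y - U x) * foldedFracKernel σ x₀ ν a x y)).add herr).const_mul
      (fracLaplacianConst n σ)
  rw [sub_self, add_zero] at hright
  refine le_of_tendsto_of_tendsto h.tendsto_fracKernel hright ?_
  have hd : 0 < min r (a - inner ℝ (x - x₀) ν) :=
    lt_min hr (sub_pos.mpr (mem_lowerHalfSpace.mp hx))
  filter_upwards [Ioo_mem_nhdsGT hd] with δ hδ
  rw [setIntegral_compl_ball_eq_fold hσ.1 hν h.1 hanti hx hδ.1 ((Metric.ball_subset_ball
    (hδ.2.le.trans (min_le_right _ _))).trans (ball_sub_inner_subset_lowerHalfSpace hν))]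
  refine mul_le_mul_of_nonneg_left (add_le_add_left (sub_le_sub_left ?_ _) _)
    (fracLaplacianConst_pos hσ).le
  refine setIntegral_mono_set (integrableOn_sub_mul_foldedFracKernel hσ.1 hν h.1 hanti hx hδ.1)
    ((ae_restrict_iff' (hSm.diff Metric.isOpen_ball.measurableSet)).mpr
      (Eventually.of_forall fun y hy => ?_)) (LE.le.eventuallyLE (hA.trans
        (sdiff_subset_sdiff_right (Metric.ball_subset_ball (hδ.2.le.trans (min_le_left _ _))))))
  have hxy : x ≠ y := fun hxy => hy.2 (hxy ▸ Metric.mem_ball_self hδ.1)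
  exact mul_nonneg (sub_nonneg.mpr (hmin y hy.1)) (foldedFracKernel_pos hσ.1 hν hx hy.1 hxy).le

theorem mul_rpow_le_setIntegral_fracKernel_compl (hσ : 0 < σ) (hν : ‖ν‖ = 1)
    (hx : x ∈ lowerHalfSpace x₀ ν a) {l : ℝ} (hl : 0 < l) (hxl : a - l ≤ inner ℝ (x - x₀) ν) :
    (3 ^ ((n : ℝ) + 2 * σ))⁻¹ * volume.real (Metric.ball (0 : En n) 1) * l ^ (-(2 * σ)) ≤
      ∫ y in (lowerHalfSpace x₀ ν a)ᶜ, fracKernel σ x y := by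
  have hint := integrableOn_fracKernel_compl (σ := σ) hσ hν hx
  set Q := Metric.closedBall (x + (2 * l) • ν) l with hQ
  have hdist : ∀ y ∈ Q, ‖x - y‖ ≤ 3 * l := fun y hy =>
    calc ‖x - y‖ = ‖(x + (2 * l) • ν - y) - (2 * l) • ν‖ := by congr 1; abel
      _ ≤ ‖x + (2 * l) • ν - y‖ + ‖(2 * l) • ν‖ := norm_sub_le _ _
      _ ≤ l + 2 * l := add_le_add (mem_closedBall_iff_norm'.mp hy)
          (by rw [norm_smul, hν, mul_one, Real.norm_of_nonneg (by positivity)])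
      _ = 3 * l := by ring
  have hheight : inner ℝ (x + (2 * l) • ν - x₀) ν = inner ℝ (x - x₀) ν + 2 * l := by
    rw [add_sub_right_comm, inner_add_left, real_inner_smul_left, real_inner_self_eq_norm_sq, hν]
    ring
  have hsub : Q ⊆ (lowerHalfSpace x₀ ν a)ᶜ := by
    intro y hy
    have h := real_inner_le_norm (x + (2 * l) • ν - y) ν
    rw [hν, mul_one, inner_sub_eq_inner_sub_sub_inner_sub x₀, hheight] at h
    rw [mem_compl_iff, mem_lowerHalfSpace, not_lt]
    linarith [mem_closedBall_iff_norm'.mp hy]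
  have hlower : ∀ y ∈ Q, ((3 * l) ^ ((n : ℝ) + 2 * σ))⁻¹ ≤ fracKernel σ x y := fun y hy =>
    inv_rpow_le_fracKernel hσ (norm_sub_pos_iff.mpr fun hxy => hsub hy (hxy ▸ hx)) (hdist y hy)
  calc (3 ^ ((n : ℝ) + 2 * σ))⁻¹ * volume.real (Metric.ball (0 : En n) 1) * l ^ (-(2 * σ))
      = ((3 * l) ^ ((n : ℝ) + 2 * σ))⁻¹ * volume.real Q := by
        rw [hQ, Measure.addHaar_real_closedBall _ _ hl.le, finrank_euclideanSpace_fin,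
          Real.mul_rpow zero_le_three hl.le, Real.rpow_add hl, Real.rpow_neg hl.le,
          Real.rpow_natCast]
        field_simp
    _ ≤ ∫ y in Q, fracKernel σ x y := setIntegral_ge_of_const_le_real
        Metric.isClosed_closedBall.measurableSet measure_closedBall_lt_top.ne hlower
        (hint.mono_set hsub)
    _ ≤ ∫ y in (lowerHalfSpace x₀ ν a)ᶜ, fracKernel σ x y := setIntegral_mono_set hint
        (Eventually.of_forall (fracKernel_nonneg x)) (LE.le.eventuallyLE hsub)

/-- The factor in the narrow region principle: at a nonpositive minimum at distance at most `l` from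
the hyperplane, `(-Δ)^σ` of an antisymmetric function `U` is at most this constant times
`l ^ (-2σ) * U`. -/
noncomputable def narrowRegionConst (n : ℕ) (σ : ℝ) : ℝ :=
  fracLaplacianConst n σ *
    (2 * ((3 ^ ((n : ℝ) + 2 * σ))⁻¹ * volume.real (Metric.ball (0 : En n) 1)))

theorem narrowRegionConst_pos (hσ : σ ∈ Ioo (0 : ℝ) 1) : 0 < narrowRegionConst n σ := by
  have hvol : 0 < volume.real (Metric.ball (0 : En n) 1) :=
    ENNReal.toReal_pos (Metric.measure_ball_pos _ _ one_pos).ne' measure_ball_lt_top.ne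
  exact mul_pos (fracLaplacianConst_pos hσ) (by positivity)

theorem HasFracLaplacianAt.le_narrowRegionConst_mul (hσ : σ ∈ Ioo (0 : ℝ) 1) (hν : ‖ν‖ = 1)
    (h : HasFracLaplacianAt σ U x L) (hanti : ∀ y, U (hyperplaneReflection x₀ ν a y) = -U y)
    (hx : x ∈ lowerHalfSpace x₀ ν a) (hmin : ∀ y ∈ lowerHalfSpace x₀ ν a, U x ≤ U y)
    (hUx : U x ≤ 0) {l : ℝ} (hl : 0 < l) (hxl : a - l ≤ inner ℝ (x - x₀) ν) :
    L ≤ narrowRegionConst n σ * l ^ (-(2 * σ)) * U x := by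
  have hle := h.le_of_forall_le hσ hν hanti hx hmin one_pos (empty_subset _)
  rw [setIntegral_empty, sub_zero] at hle
  refine (hle.trans (mul_le_mul_of_nonneg_left (mul_le_mul_of_nonpos_left
    (mul_rpow_le_setIntegral_fracKernel_compl hσ.1 hν hx hl hxl) (by linarith))
    (fracLaplacianConst_pos hσ).le)).trans_eq ?_
  rw [narrowRegionConst]
  ring

theorem HasFracLaplacianAt.neg_of_forall_le (hσ : σ ∈ Ioo (0 : ℝ) 1) (hν : ‖ν‖ = 1)
    (hU : Continuous U) (h : HasFracLaplacianAt σ U x L)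
    (hanti : ∀ y, U (hyperplaneReflection x₀ ν a y) = -U y)
    (hx : x ∈ lowerHalfSpace x₀ ν a) (hmin : ∀ y ∈ lowerHalfSpace x₀ ν a, U x ≤ U y)
    (hUx : U x ≤ 0) {z : En n} (hz : z ∈ lowerHalfSpace x₀ ν a) (hxz : U x < U z) : L < 0 := by
  have hd : 0 < ‖z - x‖ := norm_sub_pos_iff.mpr fun hzx => hxz.ne (congrArg U hzx).symm
  have hev : ∀ᶠ y in 𝓝 z, y ∈ lowerHalfSpace x₀ ν a ∧ U x < U y ∧ ‖z - x‖ / 2 < ‖y - x‖ :=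
    (isOpen_lowerHalfSpace.eventually_mem hz).and
      (((hU.tendsto z).eventually (lt_mem_nhds hxz)).and
        ((continuous_id.sub continuous_const).norm.tendsto z |>.eventually
          (lt_mem_nhds (half_lt_self hd))))
  obtain ⟨r, hr, hball⟩ := Metric.eventually_nhds_iff_ball.mp hev
  have hsub : Metric.ball z r ⊆ lowerHalfSpace x₀ ν a \ Metric.ball x (‖z - x‖ / 2) := fun y hy =>
    ⟨(hball y hy).1, fun hyx => (mem_ball_iff_norm.mp hyx).not_gt (hball y hy).2.2⟩
  have hpos : ∀ y ∈ Metric.ball z r, 0 < (U y - U x) * foldedFracKernel σ x₀ ν a x y :=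
    fun y hy => mul_pos (sub_pos.mpr (hball y hy).2.1) (foldedFracKernel_pos hσ.1 hν hx
      (hball y hy).1 fun hxy => (hball y hy).2.1.ne (congrArg U hxy))
  have hgain : 0 < ∫ y in Metric.ball z r, (U y - U x) * foldedFracKernel σ x₀ ν a x y := by
    rw [setIntegral_pos_iff_support_of_nonneg_ae]
    · exact (Metric.measure_ball_pos volume z hr).trans_le
        (measure_mono fun y hy => ⟨(hpos y hy).ne', hy⟩)
    · exact (ae_restrict_iff' Metric.isOpen_ball.measurableSet).mpr
        (Eventually.of_forall fun y hy => (hpos y hy).le)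
    · exact (integrableOn_sub_mul_foldedFracKernel hσ.1 hν h.1 hanti hx (half_pos hd)).mono_set
        hsub
  have hmass : 0 ≤ ∫ y in (lowerHalfSpace x₀ ν a)ᶜ, fracKernel σ x y :=
    integral_nonneg (fracKernel_nonneg x)
  refine (h.le_of_forall_le hσ hν hanti hx hmin (half_pos hd) hsub).trans_lt
    (mul_neg_of_pos_of_neg (fracLaplacianConst_pos hσ) ?_)
  linarith [mul_nonpos_of_nonpos_of_nonneg (by linarith : 2 * U x ≤ 0) hmass]

end Antisymmetric

/-! ### Caps at an exposed boundary point -/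

section Caps

variable {E : Type*} [NormedAddCommGroup E] [InnerProductSpace ℝ E] {Ω : Set E} {x₀ ν : E} {δ : ℝ}

/-- `x₀` is an exposed boundary point of the bounded open convex set `Ω`: the closure of `Ω` meets
the supporting hyperplane through `x₀` with inward unit normal `ν` only in `x₀`, and `ν` points into
`Ω`. -/
structure IsExposedBoundaryPoint (Ω : Set E) (x₀ ν : E) : Prop where
  isOpen : IsOpen Ω
  isBounded : Bornology.IsBounded Ω
  convex : Convex ℝ Ω
  mem_closure : x₀ ∈ closure Ω
  norm_eq_one : ‖ν‖ = 1
  inner_pos : ∀ x ∈ closure Ω, x ≠ x₀ → 0 < inner ℝ (x - x₀) ν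
  exists_add_smul_mem : ∃ t : ℝ, 0 < t ∧ x₀ + t • ν ∈ Ω

/-- The geometric input of the moving plane method: `closure Ω` lies on or above the hyperplane
through the boundary point `x₀`, and the caps of `Ω` of height at most `δ` are reflected into
`Ω`. -/
structure HasReflectingCaps (Ω : Set E) (x₀ ν : E) (δ : ℝ) : Prop where
  isOpen : IsOpen Ω
  isCompact_closure : IsCompact (closure Ω)
  mem_frontier : x₀ ∈ frontier Ω
  norm_eq_one : ‖ν‖ = 1
  inner_nonneg : ∀ x ∈ closure Ω, 0 ≤ inner ℝ (x - x₀) ν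
  reflection_mem : ∀ a ≤ δ, ∀ x ∈ closure Ω, x ∈ lowerHalfSpace x₀ ν a →
    hyperplaneReflection x₀ ν a x ∈ Ω

theorem add_smul_mem_of_mem_closure_of_convex (hconv : Convex ℝ Ω) (hopen : IsOpen Ω) {x v : E}
    {t h : ℝ} (hx : x ∈ closure Ω) (hxt : x + t • v ∈ Ω) (hh : 0 < h) (hht : h ≤ t) :
    x + h • v ∈ Ω := by
  have ht : 0 < t := hh.trans_le hht
  rw [← hopen.interior_eq] at hxt ⊢
  have h := hconv.add_smul_sub_mem_interior' hx hxt (t := h / t)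
    ⟨by positivity, (div_le_one ht).mpr hht⟩
  rwa [add_sub_cancel_left, smul_smul, div_mul_cancel₀ _ ht.ne'] at h

theorem interior_closure_eq_of_convex_of_isOpen (hconv : Convex ℝ Ω) (hopen : IsOpen Ω)
    (hne : Ω.Nonempty) : interior (closure Ω) = Ω := by
  rw [hconv.interior_closure_eq_interior_of_nonempty_interior (hopen.interior_eq.symm ▸ hne),
    hopen.interior_eq]

namespace IsExposedBoundaryPoint

theorem nonempty (h : IsExposedBoundaryPoint Ω x₀ ν) : Ω.Nonempty :=
  let ⟨_, _, ht⟩ := h.exists_add_smul_mem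
  ⟨_, ht⟩

theorem inner_nonneg (h : IsExposedBoundaryPoint Ω x₀ ν) {x : E} (hx : x ∈ closure Ω) :
    0 ≤ inner ℝ (x - x₀) ν := by
  rcases eq_or_ne x x₀ with rfl | hne
  · rw [sub_self, inner_zero_left]
  · exact (h.inner_pos x hx hne).le

theorem interior_closure (h : IsExposedBoundaryPoint Ω x₀ ν) : interior (closure Ω) = Ω :=
  interior_closure_eq_of_convex_of_isOpen h.convex h.isOpen h.nonempty

theorem uniqueDiffOn_closure (h : IsExposedBoundaryPoint Ω x₀ ν) : UniqueDiffOn ℝ (closure Ω) :=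
  uniqueDiffOn_convex h.convex.closure (h.interior_closure.symm ▸ h.nonempty)

theorem notMem (h : IsExposedBoundaryPoint Ω x₀ ν) : x₀ ∉ Ω := by
  intro hx₀
  have hcont : ContinuousAt (fun t : ℝ => x₀ - t • ν) 0 := by fun_prop
  have hnhds : Ω ∈ 𝓝 (x₀ - (0 : ℝ) • ν) := by simpa using h.isOpen.mem_nhds hx₀
  obtain ⟨t, htΩ, ht : 0 < t⟩ := (((hcont.eventually_mem hnhds).filter_mono
    (nhdsWithin_le_nhds (s := Ioi 0))).and self_mem_nhdsWithin).exists
  have hneg := h.inner_nonneg (subset_closure htΩ)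
  rw [sub_sub_cancel_left, inner_neg_left, real_inner_smul_left, real_inner_self_eq_norm_sq,
    h.norm_eq_one] at hneg
  linarith

variable [FiniteDimensional ℝ E]

theorem exists_height_lt_imp_mem_ball (h : IsExposedBoundaryPoint Ω x₀ ν) {ε : ℝ} (hε : 0 < ε) :
    ∃ δ : ℝ, 0 < δ ∧ ∀ x ∈ closure Ω, inner ℝ (x - x₀) ν < δ → x ∈ Metric.ball x₀ ε := by
  have hK : IsCompact (closure Ω \ Metric.ball x₀ ε) :=
    h.isBounded.isCompact_closure.diff Metric.isOpen_ball
  obtain ⟨δ, hδ, hmin⟩ := hK.exists_forall_le' (f := fun x => inner ℝ (x - x₀) ν)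
    (Continuous.continuousOn (by fun_prop)) (a := 0) fun x hx =>
      h.inner_pos x hx.1 fun hxx => hx.2 (hxx ▸ Metric.mem_ball_self hε)
  exact ⟨δ, hδ, fun x hx hxδ => by_contra fun hball => (hmin x ⟨hx, hball⟩).not_gt hxδ⟩

theorem exists_hasReflectingCaps (h : IsExposedBoundaryPoint Ω x₀ ν) :
    ∃ δ : ℝ, 0 < δ ∧ HasReflectingCaps Ω x₀ ν δ := by
  obtain ⟨t, ht, htΩ⟩ := h.exists_add_smul_mem
  obtain ⟨ε, hε, hball⟩ := Metric.isOpen_iff.mp h.isOpen _ htΩ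
  obtain ⟨δ, hδ, hδε⟩ := h.exists_height_lt_imp_mem_ball hε
  refine ⟨min δ (t / 2), lt_min hδ (by positivity), h.isOpen, h.isBounded.isCompact_closure,
    ⟨h.mem_closure, fun hint => h.notMem (interior_subset hint)⟩, h.norm_eq_one,
    fun x hx => h.inner_nonneg hx, fun a ha x hx hxa => ?_⟩
  rw [mem_lowerHalfSpace] at hxa
  have hxt : x + t • ν ∈ Ω := hball (by
    rw [Metric.mem_ball, dist_add_right]
    exact hδε x hx (hxa.trans_le (ha.trans (min_le_left _ _))))
  exact add_smul_mem_of_mem_closure_of_convex h.convex h.isOpen hx hxt (by linarith)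
    (by linarith [h.inner_nonneg hx, ha.trans (min_le_right δ (t / 2))])

end IsExposedBoundaryPoint

end Caps

section SmoothDomain

variable {n : ℕ} {Ω : Set (En n)} {x₀ ν : En n}

theorem IsInwardUnitNormal.norm_eq_one (h : IsInwardUnitNormal Ω x₀ ν) : ‖ν‖ = 1 := by
  obtain ⟨ρ, hρ, rfl⟩ := h
  exact norm_smul_inv_norm (𝕜 := ℝ) hρ.grad_ne_zero

theorem IsLocalDefiningFunction.hasDerivAt_line {ρ : En n → ℝ}
    (h : IsLocalDefiningFunction Ω x₀ ρ) (v : En n) :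
    HasDerivAt (fun t : ℝ => ρ (x₀ + t • v)) (inner ℝ (gradient ρ x₀) v) 0 := by
  obtain ⟨U, hU, hs⟩ := h.smooth
  have hd : DifferentiableAt ℝ ρ x₀ := (hs.contDiffAt hU).differentiableAt (by simp)
  have hgrad : HasFDerivAt ρ (InnerProductSpace.toDual ℝ (En n) (gradient ρ x₀))
      (x₀ + (0 : ℝ) • v) := by
    simpa using hd.hasGradientAt.hasFDerivAt
  exact hgrad.comp_hasDerivAt (0 : ℝ) (_root_.hasDerivAt_line x₀ v 0)

theorem IsLocalDefiningFunction.eventually_line_mem_iff {ρ : En n → ℝ}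
    (h : IsLocalDefiningFunction Ω x₀ ρ) (v : En n) :
    ∀ᶠ t : ℝ in 𝓝[>] 0, (x₀ + t • v ∈ Ω ↔ 0 < ρ (x₀ + t • v)) := by
  have hcont : ContinuousAt (fun t : ℝ => x₀ + t • v) 0 := by fun_prop
  have hmem : ∀ᶠ y in 𝓝 (x₀ + (0 : ℝ) • v), (y ∈ Ω ↔ 0 < ρ y) := by
    simpa using h.eventually_mem_iff
  exact (hcont.eventually hmem).filter_mono nhdsWithin_le_nhds

theorem IsLocalDefiningFunction.eventually_mem {ρ : En n → ℝ}
    (h : IsLocalDefiningFunction Ω x₀ ρ) {v : En n} (hv : 0 < inner ℝ (gradient ρ x₀) v) :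
    ∀ᶠ t : ℝ in 𝓝[>] 0, x₀ + t • v ∈ Ω := by
  have hsign := eventually_nhdsWithin_sign_eq_of_deriv_pos
    ((h.hasDerivAt_line v).deriv.symm ▸ hv) (by simpa using h.zero)
  filter_upwards [hsign.filter_mono nhdsWithin_le_nhds, h.eventually_line_mem_iff v,
    self_mem_nhdsWithin] with t ht hmem (htpos : 0 < t)
  rwa [hmem, ← sign_eq_one_iff, ht, sub_zero, sign_eq_one_iff]

theorem IsLocalDefiningFunction.eventually_notMem {ρ : En n → ℝ}
    (h : IsLocalDefiningFunction Ω x₀ ρ) {v : En n} (hv : inner ℝ (gradient ρ x₀) v < 0) :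
    ∀ᶠ t : ℝ in 𝓝[>] 0, x₀ + t • v ∉ Ω := by
  have hsign := eventually_nhdsWithin_sign_eq_of_deriv_neg
    ((h.hasDerivAt_line v).deriv.symm ▸ hv) (by simpa using h.zero)
  filter_upwards [hsign.filter_mono nhdsWithin_le_nhds, h.eventually_line_mem_iff v,
    self_mem_nhdsWithin] with t ht hmem (htpos : 0 < t)
  have hneg : ρ (x₀ + t • v) < 0 := by
    rwa [← sign_eq_neg_one_iff, ht, zero_sub, Left.sign_neg, neg_inj, sign_eq_one_iff]
  exact fun hΩ => hneg.not_gt (hmem.mp hΩ)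

namespace IsSmoothStrictlyConvexDomain

theorem inner_nonneg (hΩ : IsSmoothStrictlyConvexDomain Ω) (hx₀ : x₀ ∈ frontier Ω)
    (hν : IsInwardUnitNormal Ω x₀ ν) {x : En n} (hx : x ∈ closure Ω) :
    0 ≤ inner ℝ (x - x₀) ν := by
  refine closure_minimal (t := {y : En n | 0 ≤ inner ℝ (y - x₀) ν}) (fun y hy => ?_)
    (isClosed_le continuous_const (by fun_prop)) hx
  obtain ⟨ρ, hρ, rfl⟩ := hν
  rw [mem_ofPred_eq, real_inner_smul_right, real_inner_comm]
  by_contra! hneg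
  have hgrad : inner ℝ (gradient ρ x₀) (y - x₀) < 0 :=
    (pos_iff_neg_of_mul_neg hneg).mp (inv_pos.mpr (norm_pos_iff.mpr hρ.grad_ne_zero))
  obtain ⟨t, hnot, ht⟩ := ((hρ.eventually_notMem hgrad).and (Ioo_mem_nhdsGT one_pos)).exists
  exact hnot (add_smul_mem_of_mem_closure_of_convex hΩ.convex hΩ.isOpen
    (frontier_subset_closure hx₀) (t := 1) (by simpa using hy) ht.1 ht.2.le)

theorem inner_pos_of_mem (hΩ : IsSmoothStrictlyConvexDomain Ω) (hx₀ : x₀ ∈ frontier Ω)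
    (hν : IsInwardUnitNormal Ω x₀ ν) {x : En n} (hx : x ∈ Ω) : 0 < inner ℝ (x - x₀) ν := by
  have hcont : ContinuousAt (fun t : ℝ => x - t • ν) 0 := by fun_prop
  have hnhds : Ω ∈ 𝓝 (x - (0 : ℝ) • ν) := by simpa using hΩ.isOpen.mem_nhds hx
  obtain ⟨t, htΩ, ht : 0 < t⟩ := (((hcont.eventually_mem hnhds).filter_mono
    (nhdsWithin_le_nhds (s := Ioi 0))).and self_mem_nhdsWithin).exists
  have h := hΩ.inner_nonneg hx₀ hν (subset_closure htΩ)
  rw [sub_right_comm, inner_sub_left, real_inner_smul_left, real_inner_self_eq_norm_sq,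
    hν.norm_eq_one] at h
  linarith

theorem isExposedBoundaryPoint (hΩ : IsSmoothStrictlyConvexDomain Ω) (hx₀ : x₀ ∈ frontier Ω)
    (hν : IsInwardUnitNormal Ω x₀ ν) : IsExposedBoundaryPoint Ω x₀ ν where
  isOpen := hΩ.isOpen
  isBounded := hΩ.isBounded
  convex := hΩ.convex
  mem_closure := frontier_subset_closure hx₀
  norm_eq_one := hν.norm_eq_one
  inner_pos x hx hne := by
    have hmid := hΩ.strictConvex_closure hx (frontier_subset_closure hx₀) hne
      (a := 1 / 2) (b := 1 / 2) (by norm_num) (by norm_num) (by norm_num)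
    rw [interior_closure_eq_of_convex_of_isOpen hΩ.convex hΩ.isOpen hΩ.nonempty] at hmid
    have hpos := hΩ.inner_pos_of_mem hx₀ hν hmid
    rw [show (1 / 2 : ℝ) • x + (1 / 2 : ℝ) • x₀ - x₀ = (1 / 2 : ℝ) • (x - x₀) by module,
      real_inner_smul_left] at hpos
    linarith
  exists_add_smul_mem := by
    obtain ⟨ρ, hρ, hνρ⟩ := hν
    have hgrad : 0 < inner ℝ (gradient ρ x₀) ν := by
      have : 0 < ‖gradient ρ x₀‖ := norm_pos_iff.mpr hρ.grad_ne_zero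
      rw [hνρ, real_inner_smul_right, real_inner_self_eq_norm_sq]
      positivity
    obtain ⟨t, ht, htpos⟩ := ((hρ.eventually_mem hgrad).and self_mem_nhdsWithin).exists
    exact ⟨t, htpos, ht⟩

end IsSmoothStrictlyConvexDomain

end SmoothDomain

/-! ### Navier chains -/

/-- Functions `w 0, …, w m` vanishing outside `Ω` with `-Δ (w i) = w (i + 1)` and
`(-Δ)^σ (w m) = f > 0` in `Ω`: the equation `(-Δ)^{m+σ} (w 0) = f` with Navier exterior conditions,
written as a system of second order equations and one fractional equation. -/
structure IsNavierChain {n : ℕ} (Ω : Set (En n)) (m : ℕ) (σ : ℝ) (w : ℕ → En n → ℝ)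
    (f : En n → ℝ) : Prop where
  exponent_mem : σ ∈ Ioo (0 : ℝ) 1
  continuous : ∀ i ≤ m, Continuous (w i)
  eq_zero : ∀ i ≤ m, ∀ x ∉ Ω, w i x = 0
  contDiffAt : ∀ i < m, ∀ x ∈ Ω, ContDiffAt ℝ 2 (w i) x
  laplacian_eq : ∀ i < m, ∀ x ∈ Ω, Laplacian.laplacian (w i) x = -w (i + 1) x
  hasFracLaplacianAt : ∀ x ∈ Ω, HasFracLaplacianAt σ (w m) x (f x)
  rhs_pos : ∀ x ∈ Ω, 0 < f x

namespace IsNavierChain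

variable {n : ℕ} {Ω : Set (En n)} {m : ℕ} {σ : ℝ} {w : ℕ → En n → ℝ} {f : En n → ℝ} {i : ℕ}

theorem exists_bound (h : IsNavierChain Ω m σ w f) (hK : IsCompact (closure Ω)) (hi : i ≤ m) :
    ∃ B : ℝ, ∀ x, |w i x| ≤ B := by
  obtain ⟨B, hB⟩ := hK.exists_bound_of_continuousOn (h.continuous i hi).continuousOn
  refine ⟨max B 0, fun x => ?_⟩
  by_cases hx : x ∈ Ω
  · exact (hB x (subset_closure hx)).trans (le_max_left _ _)
  · rw [h.eq_zero i hi x hx, abs_zero]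
    exact le_max_right _ _

theorem exists_forall_le (h : IsNavierChain Ω m σ w f) (hK : IsCompact (closure Ω)) (hi : i ≤ m)
    {x : En n} (hx : x ∈ Ω) (hwx : w i x ≤ 0) : ∃ z ∈ Ω, ∀ y, w i z ≤ w i y := by
  obtain ⟨z, -, hmin⟩ := hK.exists_isMinOn ⟨x, subset_closure hx⟩ (h.continuous i hi).continuousOn
  have hzx : w i z ≤ w i x := hmin (subset_closure hx)
  have hglobal : ∀ y, w i z ≤ w i y := fun y => by
    by_cases hy : y ∈ Ω
    · exact hmin (subset_closure hy)
    · exact h.eq_zero i hi y hy ▸ hzx.trans hwx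
  by_cases hz : z ∈ Ω
  · exact ⟨z, hz, hglobal⟩
  · exact ⟨x, hx, fun y => (hwx.trans_eq (h.eq_zero i hi z hz).symm).trans (hglobal y)⟩

theorem pos (h : IsNavierChain Ω m σ w f) (hK : IsCompact (closure Ω)) (hi : i ≤ m) :
    ∀ x ∈ Ω, 0 < w i x := by
  induction hi using Nat.decreasingInduction with
  | self =>
    intro x hx
    by_contra! hneg
    obtain ⟨z, hz, hmin⟩ := h.exists_forall_le hK le_rfl hx hneg
    exact ((h.hasFracLaplacianAt z hz).nonpos_of_forall_le h.exponent_mem hmin).not_gt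
      (h.rhs_pos z hz)
  | of_succ k hk ih =>
    intro x hx
    by_contra! hneg
    obtain ⟨z, hz, hmin⟩ := h.exists_forall_le hK hk.le hx hneg
    have hlap := laplacian_nonneg_of_isLocalMin (Eventually.of_forall hmin) (h.contDiffAt k hk z hz)
    rw [h.laplacian_eq k hk z hz] at hlap
    linarith [ih z hz]

theorem nonneg (h : IsNavierChain Ω m σ w f) (hK : IsCompact (closure Ω)) (hi : i ≤ m) (x : En n) :
    0 ≤ w i x := by
  by_cases hx : x ∈ Ω
  · exact (h.pos hK hi x hx).le
  · exact (h.eq_zero i hi x hx).ge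

variable {x₀ ν x : En n} {a δ l : ℝ}

theorem reflectionDiff_nonneg_of_notMem (h : IsNavierChain Ω m σ w f) (hK : IsCompact (closure Ω))
    (hi : i ≤ m) (hx : x ∉ Ω) : 0 ≤ reflectionDiff x₀ ν a (w i) x := by
  rw [reflectionDiff, h.eq_zero i hi x hx, sub_zero]
  exact h.nonneg hK hi _

theorem mem_of_reflectionDiff_neg (h : IsNavierChain Ω m σ w f) (hK : IsCompact (closure Ω))
    (hi : i ≤ m) (hx : x ∈ cap Ω x₀ ν a) (hneg : reflectionDiff x₀ ν a (w i) x < 0) :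
    x ∈ Ω ∧ x ∈ lowerHalfSpace x₀ ν a :=
  ⟨by_contra fun hxΩ => hneg.not_ge (h.reflectionDiff_nonneg_of_notMem hK hi hxΩ),
    lt_of_le_of_ne hx.2 fun hxa => hneg.ne (reflectionDiff_of_inner_eq hxa)⟩

theorem forall_lowerHalfSpace_le (h : IsNavierChain Ω m σ w f) (hK : IsCompact (closure Ω))
    (hi : i ≤ m) {b : ℝ} (hb : b ≤ 0)
    (hcap : ∀ y ∈ cap Ω x₀ ν a, b ≤ reflectionDiff x₀ ν a (w i) y) :
    ∀ y ∈ lowerHalfSpace x₀ ν a, b ≤ reflectionDiff x₀ ν a (w i) y := fun y hy => by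
  by_cases hyΩ : y ∈ Ω
  · exact hcap y ⟨subset_closure hyΩ, le_of_lt hy⟩
  · exact hb.trans (h.reflectionDiff_nonneg_of_notMem hK hi hyΩ)

variable (h : IsNavierChain Ω m σ w f) (hc : HasReflectingCaps Ω x₀ ν δ) (ha : a ≤ δ)

include h hc ha

theorem contDiffAt_reflectionDiff (hi : i < m) (hx : x ∈ Ω) (hxa : x ∈ lowerHalfSpace x₀ ν a) :
    ContDiffAt ℝ 2 (reflectionDiff x₀ ν a (w i)) x :=
  ((h.contDiffAt i hi _ (hc.reflection_mem a ha x (subset_closure hx) hxa)).comp x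
    contDiff_hyperplaneReflection.contDiffAt).sub (h.contDiffAt i hi x hx)

theorem laplacian_reflectionDiff_eq (hi : i < m) (hx : x ∈ Ω) (hxa : x ∈ lowerHalfSpace x₀ ν a) :
    Laplacian.laplacian (reflectionDiff x₀ ν a (w i)) x =
      -reflectionDiff x₀ ν a (w (i + 1)) x := by
  have hRx := hc.reflection_mem a ha x (subset_closure hx) hxa
  rw [laplacian_reflectionDiff hc.norm_eq_one (h.contDiffAt i hi _ hRx) (h.contDiffAt i hi x hx),
    h.laplacian_eq i hi _ hRx, h.laplacian_eq i hi x hx, reflectionDiff]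
  ring

theorem hasFracLaplacianAt_reflectionDiff (hx : x ∈ Ω) (hxa : x ∈ lowerHalfSpace x₀ ν a) :
    HasFracLaplacianAt σ (reflectionDiff x₀ ν a (w m)) x (reflectionDiff x₀ ν a f x) := by
  obtain ⟨B, hB⟩ := h.exists_bound hc.isCompact_closure le_rfl
  exact HasFracLaplacianAt.reflection_sub h.exponent_mem.1 hc.norm_eq_one (h.continuous m le_rfl) hB
    (h.hasFracLaplacianAt x hx)
    (h.hasFracLaplacianAt _ (hc.reflection_mem a ha x (subset_closure hx) hxa))

theorem neg_le_reflectionDiff_of_succ (hl : l ≤ 1) (hi : i < m)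
    (hfar : ∀ x ∈ cap Ω x₀ ν (a - l), 0 ≤ reflectionDiff x₀ ν a (w i) x) {M : ℝ} (hM : 0 ≤ M)
    (hsucc : ∀ x ∈ cap Ω x₀ ν a, -M ≤ reflectionDiff x₀ ν a (w (i + 1)) x) :
    ∀ x ∈ cap Ω x₀ ν a, -M ≤ reflectionDiff x₀ ν a (w i) x := by
  intro x hx
  by_cases hxl : inner ℝ (x - x₀) ν ≤ a - l
  · exact (neg_nonpos.mpr hM).trans (hfar x ⟨hx.1, hxl⟩)
  set K : Set (En n) := cap Ω x₀ ν a ∩ {y | a - l ≤ inner ℝ (y - x₀) ν}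
  have hheight : Continuous fun y : En n => inner ℝ (y - x₀) ν := by fun_prop
  have hK : IsCompact K :=
    (isCompact_cap hc.isCompact_closure).inter_right (isClosed_le continuous_const hheight)
  have hslab : ∀ y ∈ K, |inner ℝ y ν - (inner ℝ x₀ ν + a)| ≤ l := fun y hy => by
    rw [← sub_sub, ← inner_sub_left, abs_le]
    exact ⟨by linarith [hy.2.out], by linarith [hy.1.2, hy.2.out]⟩
  have hle := neg_le_of_laplacian_le_of_slab (U := reflectionDiff x₀ ν a (w i)) hK hc.norm_eq_one
    hslab (continuous_reflectionDiff (h.continuous i hi.le)).continuousOn hM (fun y hy hneg => ?_) x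
    ⟨hx, (not_le.mp hxl).le⟩
  · have hl0 : 0 ≤ l := by linarith [not_le.mp hxl, hx.2]
    nlinarith [pow_le_one₀ hl0 hl (n := 2)]
  · obtain ⟨hyΩ, hya⟩ := h.mem_of_reflectionDiff_neg hc.isCompact_closure hi.le hy.1 hneg
    have hyl : a - l < inner ℝ (y - x₀) ν :=
      not_le.mp fun hyl => hneg.not_ge (hfar y ⟨hy.1.1, hyl⟩)
    refine ⟨inter_mem (cap_mem_nhds hc.isOpen hyΩ hya)
      ((hheight.tendsto y).eventually (lt_mem_nhds hyl) |>.mono fun _ => le_of_lt),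
      h.contDiffAt_reflectionDiff hc ha hi hyΩ hya, ?_⟩
    rw [h.laplacian_reflectionDiff_eq hc ha hi hyΩ hya]
    linarith [hsucc y hy.1]

theorem neg_le_reflectionDiff_of_last (hl : l ≤ 1)
    (hfar : ∀ i ≤ m, ∀ x ∈ cap Ω x₀ ν (a - l), 0 ≤ reflectionDiff x₀ ν a (w i) x) {M : ℝ}
    (hM : 0 ≤ M) (hlast : ∀ x ∈ cap Ω x₀ ν a, -M ≤ reflectionDiff x₀ ν a (w m) x) (hi : i ≤ m) :
    ∀ x ∈ cap Ω x₀ ν a, -M ≤ reflectionDiff x₀ ν a (w i) x := by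
  induction hi using Nat.decreasingInduction with
  | self => exact hlast
  | of_succ k hk ih => exact h.neg_le_reflectionDiff_of_succ hc ha hl hk (hfar k hk.le) hM ih

theorem neg_div_le_reflectionDiff_last (hl : 0 < l)
    (hfar : ∀ x ∈ cap Ω x₀ ν (a - l), 0 ≤ reflectionDiff x₀ ν a (w m) x) {N k : ℝ} (hN : 0 ≤ N)
    (hk : 0 < k) (hkl : k ≤ narrowRegionConst n σ * l ^ (-(2 * σ)))
    (hf : ∀ x ∈ cap Ω x₀ ν a, -N ≤ reflectionDiff x₀ ν a f x) :
    ∀ x ∈ cap Ω x₀ ν a, -(N / k) ≤ reflectionDiff x₀ ν a (w m) x := by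
  intro x hx
  obtain ⟨z, hz, hmin⟩ := (isCompact_cap hc.isCompact_closure).exists_isMinOn ⟨x, hx⟩
    (continuous_reflectionDiff (x₀ := x₀) (ν := ν) (a := a) (h.continuous m le_rfl)).continuousOn
  refine le_trans ?_ (hmin hx)
  rcases le_or_gt 0 (reflectionDiff x₀ ν a (w m) z) with hnonneg | hneg
  · exact (neg_nonpos.mpr (by positivity)).trans hnonneg
  obtain ⟨hzΩ, hza⟩ := h.mem_of_reflectionDiff_neg hc.isCompact_closure le_rfl hz hneg
  have hzl : a - l < inner ℝ (z - x₀) ν := not_le.mp fun hzl => hneg.not_ge (hfar z ⟨hz.1, hzl⟩)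
  have hnarrow := (h.hasFracLaplacianAt_reflectionDiff hc ha hzΩ hza).le_narrowRegionConst_mul
    h.exponent_mem hc.norm_eq_one (reflectionDiff_hyperplaneReflection hc.norm_eq_one) hza
    (h.forall_lowerHalfSpace_le hc.isCompact_closure le_rfl hneg.le hmin) hneg.le hl hzl.le
  rw [← neg_div, div_le_iff₀' hk]
  exact ((hf z hz).trans hnarrow).trans (mul_le_mul_of_nonpos_right hkl hneg.le)

theorem reflectionDiff_pos_of_notMem (hi : i ≤ m) (hx : x ∈ closure Ω) (hxΩ : x ∉ Ω)
    (hxa : x ∈ lowerHalfSpace x₀ ν a) : 0 < reflectionDiff x₀ ν a (w i) x := by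
  rw [reflectionDiff, h.eq_zero i hi x hxΩ, sub_zero]
  exact h.pos hc.isCompact_closure hi _ (hc.reflection_mem a ha x hx hxa)

theorem reflectionDiff_last_pos (ha0 : 0 < a)
    (hnonneg : ∀ x ∈ cap Ω x₀ ν a, 0 ≤ reflectionDiff x₀ ν a (w m) x)
    (hf : ∀ x ∈ cap Ω x₀ ν a, 0 ≤ reflectionDiff x₀ ν a f x) (hx : x ∈ Ω)
    (hxa : x ∈ lowerHalfSpace x₀ ν a) : 0 < reflectionDiff x₀ ν a (w m) x := by
  have hxcap : x ∈ cap Ω x₀ ν a := ⟨subset_closure hx, le_of_lt hxa⟩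
  refine (hnonneg x hxcap).lt_of_ne' fun hzero => (hf x hxcap).not_gt ?_
  have hx₀a : x₀ ∈ lowerHalfSpace x₀ ν a := by simpa [mem_lowerHalfSpace] using ha0
  have hx₀Ω : x₀ ∉ Ω := (hc.isOpen.frontier_eq ▸ hc.mem_frontier).2
  refine (h.hasFracLaplacianAt_reflectionDiff hc ha hx hxa).neg_of_forall_le h.exponent_mem
    hc.norm_eq_one (continuous_reflectionDiff (h.continuous m le_rfl))
    (reflectionDiff_hyperplaneReflection hc.norm_eq_one) hxa ?_ hzero.le hx₀a ?_
  · rw [hzero]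
    exact h.forall_lowerHalfSpace_le hc.isCompact_closure le_rfl le_rfl hnonneg
  · rw [hzero]
    exact h.reflectionDiff_pos_of_notMem hc ha le_rfl (frontier_subset_closure hc.mem_frontier) hx₀Ω
      hx₀a

theorem reflectionDiff_pos (ha0 : 0 < a)
    (hnonneg : ∀ i ≤ m, ∀ x ∈ cap Ω x₀ ν a, 0 ≤ reflectionDiff x₀ ν a (w i) x)
    (hf : ∀ x ∈ cap Ω x₀ ν a, 0 ≤ reflectionDiff x₀ ν a f x) (hi : i ≤ m) :
    ∀ x ∈ closure Ω, x ∈ lowerHalfSpace x₀ ν a → 0 < reflectionDiff x₀ ν a (w i) x := by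
  suffices hΩ : ∀ x ∈ Ω, x ∈ lowerHalfSpace x₀ ν a → 0 < reflectionDiff x₀ ν a (w i) x by
    intro x hx hxa
    by_cases hxΩ : x ∈ Ω
    · exact hΩ x hxΩ hxa
    · exact h.reflectionDiff_pos_of_notMem hc ha hi hx hxΩ hxa
  induction hi using Nat.decreasingInduction with
  | self => exact fun x => h.reflectionDiff_last_pos hc ha ha0 (hnonneg m le_rfl) hf
  | of_succ k hk ih =>
    intro x hx hxa
    refine (hnonneg k hk.le x ⟨subset_closure hx, le_of_lt hxa⟩).lt_of_ne' fun hzero => ?_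
    have hmin : IsLocalMin (reflectionDiff x₀ ν a (w k)) x :=
      Eventually.mono (cap_mem_nhds hc.isOpen hx hxa) fun y hy => by
        rw [hzero]
        exact hnonneg k hk.le y hy
    have hlap := laplacian_nonneg_of_isLocalMin hmin (h.contDiffAt_reflectionDiff hc ha hk hx hxa)
    rw [h.laplacian_reflectionDiff_eq hc ha hk hx hxa] at hlap
    linarith [ih x hx hxa]

end IsNavierChain

/-! ### Moving planes for coupled chains -/

section NavierSystem

theorem neg_mul_le_sub_of_monotoneOn_of_lipschitzOnWith {g : ℝ → ℝ} {C : NNReal} {S : Set ℝ}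
    (hmono : MonotoneOn g S) (hlip : LipschitzOnWith C g S) {s t M : ℝ} (hs : s ∈ S) (ht : t ∈ S)
    (hM : 0 ≤ M) (hst : -M ≤ s - t) : -(C * M) ≤ g s - g t := by
  rcases le_total t s with hts | hst'
  · exact (neg_nonpos.mpr (by positivity)).trans (sub_nonneg.mpr (hmono ht hs hts))
  · have hdist := hlip.dist_le_mul s hs t ht
    rw [Real.dist_eq, Real.dist_eq, abs_of_nonpos (sub_nonpos.mpr hst')] at hdist
    exact (neg_le_neg (hdist.trans (mul_le_mul_of_nonneg_left (by linarith) C.coe_nonneg))).trans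
      (neg_abs_le _)

theorem nonneg_of_forall_neg_half_le {α : Type*} {g : α → ℝ} {M : ℝ} (hM0 : 0 ≤ M)
    (hM : ∀ x, -M ≤ g x)
    (hhalf : ∀ N : ℝ, 0 ≤ N → (∀ x, -N ≤ g x) → ∀ x, -(N / 2) ≤ g x) (x : α) : 0 ≤ g x := by
  have hpow : ∀ j : ℕ, ∀ x, -(M * (1 / 2) ^ j) ≤ g x := fun j => by
    induction j with
    | zero => simpa using hM
    | succ j ih => exact fun x => (hhalf _ (by positivity) ih x).trans_eq' (by ring)
  have hlim : Tendsto (fun j : ℕ => -(M * (1 / 2) ^ j)) atTop (𝓝 0) := by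
    simpa using ((tendsto_pow_atTop_nhds_zero_of_lt_one (r := (1 / 2 : ℝ)) (by norm_num)
      (by norm_num)).const_mul M).neg
  exact le_of_tendsto' hlim fun j => hpow j x

variable {n : ℕ} {Ω : Set (En n)} {x₀ ν x : En n} {a δ l : ℝ} {ι : Type*} {m : ι → ℕ} {σ : ι → ℝ}
  {F : ι → ℝ → ℝ} {τ : ι → ι} {w : ι → ℕ → En n → ℝ}

theorem exists_forall_le_narrowRegionConst_mul [Finite ι] (hσ : ∀ k, σ k ∈ Ioo (0 : ℝ) 1)
    (C : ι → ℝ) :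
    ∃ l ∈ Ioo (0 : ℝ) 1, ∀ k, C k ≤ narrowRegionConst n (σ k) * l ^ (-(2 * σ k)) := by
  have hlarge : ∀ k, ∀ᶠ l : ℝ in 𝓝[>] 0, C k ≤ narrowRegionConst n (σ k) * l ^ (-(2 * σ k)) :=
    fun k => (Tendsto.const_mul_atTop (narrowRegionConst_pos (hσ k)) (tendsto_rpow_neg_nhdsGT_zero
      (neg_neg_of_pos (mul_pos two_pos (hσ k).1)))).eventually_ge_atTop (C k)
  exact ((eventually_mem_set.mpr (Ioo_mem_nhdsGT one_pos)).and
    (eventually_all.mpr hlarge)).exists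

/-- The nonlinearities `F` admitted on the right-hand sides, modelled on `F r = r ^ p` with
`1 ≤ p`; only their values on `[0, ∞)` matter. -/
structure IsMonotoneNonlinearity (F : ℝ → ℝ) : Prop where
  pos : ∀ r, 0 < r → 0 < F r
  monotoneOn : MonotoneOn F (Ici 0)
  locallyLipschitzOn : LocallyLipschitzOn (Ici 0) F

theorem isMonotoneNonlinearity_rpow {p : ℝ} (hp : 1 ≤ p) :
    IsMonotoneNonlinearity fun r => r ^ p where
  pos _ hr := Real.rpow_pos_of_pos hr p
  monotoneOn _ hr _ _ hrs := Real.rpow_le_rpow hr hrs (zero_le_one.trans hp)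
  locallyLipschitzOn := (Real.contDiff_rpow_const_of_le
    (n := 1) (by exact_mod_cast hp)).locallyLipschitz.locallyLipschitzOn

/-- A system of chains `w k` for the equations `(-Δ)^{m k + σ k} (w k 0) = F k (w (τ k) 0)`, in
which `τ k` is the unknown on the right-hand side of the `k`-th equation. -/
structure IsNavierSystem (Ω : Set (En n)) (m : ι → ℕ) (σ : ι → ℝ) (F : ι → ℝ → ℝ) (τ : ι → ι)
    (w : ι → ℕ → En n → ℝ) : Prop where
  nonlinearity : ∀ k, IsMonotoneNonlinearity (F k)
  isNavierChain : ∀ k, IsNavierChain Ω (m k) (σ k) (w k) fun x => F k (w (τ k) 0 x)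

/-- On `S`, all members of the chains are at most their reflections in the hyperplane
`{x | ⟪x - x₀, ν⟫ = a}`. -/
def ReflectionDiffNonneg (m : ι → ℕ) (w : ι → ℕ → En n → ℝ) (x₀ ν : En n) (a : ℝ)
    (S : Set (En n)) : Prop :=
  ∀ k, ∀ i ≤ m k, ∀ x ∈ S, 0 ≤ reflectionDiff x₀ ν a (w k i) x

namespace IsNavierSystem

variable (h : IsNavierSystem Ω m σ F τ w)

include h

theorem exists_neg_mul_le_reflectionDiff (hK : IsCompact (closure Ω)) (k : ι) :
    ∃ C : ℝ, 0 ≤ C ∧ ∀ (x₀ ν : En n) (a : ℝ) (x : En n) (M : ℝ), 0 ≤ M →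
      -M ≤ reflectionDiff x₀ ν a (w (τ k) 0) x →
        -(C * M) ≤ reflectionDiff x₀ ν a (fun y => F k (w (τ k) 0 y)) x := by
  obtain ⟨B, hB⟩ := (h.isNavierChain (τ k)).exists_bound hK (Nat.zero_le _)
  have hrange : ∀ y, w (τ k) 0 y ∈ Icc 0 B := fun y =>
    ⟨(h.isNavierChain (τ k)).nonneg hK (Nat.zero_le _) y, (le_abs_self _).trans (hB y)⟩
  obtain ⟨C, hC⟩ := ((h.nonlinearity k).locallyLipschitzOn.mono
    Icc_subset_Ici_self).exists_lipschitzOnWith_of_compact (isCompact_Icc (a := 0) (b := B))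
  exact ⟨C, C.coe_nonneg, fun x₀ ν a x M hM hle => neg_mul_le_sub_of_monotoneOn_of_lipschitzOnWith
    ((h.nonlinearity k).monotoneOn.mono Icc_subset_Ici_self) hC (hrange _) (hrange _) hM hle⟩

theorem isClosed_setOf_reflectionDiffNonneg :
    IsClosed {a | ReflectionDiffNonneg m w x₀ ν a (cap Ω x₀ ν a)} := by
  simp only [ReflectionDiffNonneg, ofPred_forall]
  exact isClosed_iInter fun k => isClosed_iInter fun i => isClosed_iInter fun hi => by
    simpa only [ofPred_forall] using
      isClosed_setOf_reflectionDiff_nonneg ((h.isNavierChain k).continuous i hi)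

theorem reflectionDiff_pos_of_mem_cap (hc : HasReflectingCaps Ω x₀ ν δ) (ha : a ≤ δ)
    (hnonneg : ReflectionDiffNonneg m w x₀ ν a (cap Ω x₀ ν a)) {b : ℝ} (hb : b < a) (k : ι) {i : ℕ}
    (hi : i ≤ m k) : ∀ x ∈ cap Ω x₀ ν b, 0 < reflectionDiff x₀ ν a (w k i) x := by
  intro x hx
  have hxa : inner ℝ (x - x₀) ν < a := hx.2.trans_lt hb
  have hw := (h.isNavierChain (τ k)).nonneg hc.isCompact_closure (Nat.zero_le _)
  have hrhs : ∀ y ∈ cap Ω x₀ ν a, 0 ≤ reflectionDiff x₀ ν a (fun y => F k (w (τ k) 0 y)) y :=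
    fun y hy => sub_nonneg.mpr ((h.nonlinearity k).monotoneOn (hw _) (hw _)
      (sub_nonneg.mp (hnonneg (τ k) 0 (Nat.zero_le _) y hy)))
  exact (h.isNavierChain k).reflectionDiff_pos hc ha ((hc.inner_nonneg x hx.1).trans_lt hxa)
    (hnonneg k) hrhs hi x hx.1 hxa

theorem neg_half_le_reflectionDiff_last (hc : HasReflectingCaps Ω x₀ ν δ) (ha : a ≤ δ)
    {C : ι → ℝ} (hC0 : ∀ k, 0 ≤ C k)
    (hC : ∀ k x M, 0 ≤ M → -M ≤ reflectionDiff x₀ ν a (w (τ k) 0) x →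
      -(C k * M) ≤ reflectionDiff x₀ ν a (fun y => F k (w (τ k) 0 y)) x)
    (hl : l ∈ Ioo (0 : ℝ) 1)
    (hCl : ∀ k, 2 * C k + 1 ≤ narrowRegionConst n (σ k) * l ^ (-(2 * σ k)))
    (hfar : ReflectionDiffNonneg m w x₀ ν a (cap Ω x₀ ν (a - l))) {M : ℝ} (hM : 0 ≤ M)
    (hlast : ∀ k, ∀ x ∈ cap Ω x₀ ν a, -M ≤ reflectionDiff x₀ ν a (w k (m k)) x) (k : ι) :
    ∀ x ∈ cap Ω x₀ ν a, -(M / 2) ≤ reflectionDiff x₀ ν a (w k (m k)) x := by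
  have hfirst : ∀ x ∈ cap Ω x₀ ν a, -M ≤ reflectionDiff x₀ ν a (w (τ k) 0) x :=
    (h.isNavierChain (τ k)).neg_le_reflectionDiff_of_last hc ha hl.2.le (hfar (τ k)) hM
      (hlast (τ k)) (Nat.zero_le _)
  have hpos : 0 < 2 * C k + 1 := by linarith [hC0 k]
  have hdiv : C k * M / (2 * C k + 1) ≤ M / 2 := by
    rw [div_le_div_iff₀ hpos two_pos]
    linarith
  exact fun x hx => (neg_le_neg hdiv).trans ((h.isNavierChain k).neg_div_le_reflectionDiff_last hc
    ha hl.1 (hfar k _ le_rfl) (mul_nonneg (hC0 k) hM) hpos (hCl k)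
    (fun y hy => hC k y M hM (hfirst y hy)) x hx)

variable [Finite ι]

theorem exists_reflectionDiffNonneg_of_far (hc : HasReflectingCaps Ω x₀ ν δ) :
    ∃ l : ℝ, 0 < l ∧ ∀ a ≤ δ, ReflectionDiffNonneg m w x₀ ν a (cap Ω x₀ ν (a - l)) →
      ReflectionDiffNonneg m w x₀ ν a (cap Ω x₀ ν a) := by
  choose C hC0 hC using h.exists_neg_mul_le_reflectionDiff hc.isCompact_closure
  obtain ⟨l, hl, hCl⟩ := exists_forall_le_narrowRegionConst_mul (n := n)
    (fun k => (h.isNavierChain k).exponent_mem) fun k => 2 * C k + 1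
  choose B hB using fun k => (h.isNavierChain k).exists_bound hc.isCompact_closure le_rfl
  obtain ⟨M, hM⟩ := Finite.exists_le B
  refine ⟨l, hl.1, fun a ha hfar => ?_⟩
  have hlast : ∀ p : ι × cap Ω x₀ ν a, 0 ≤ reflectionDiff x₀ ν a (w p.1 (m p.1)) p.2 := by
    refine nonneg_of_forall_neg_half_le (M := 2 * |M|) (by positivity) (fun p => ?_)
      fun N hN0 hN p => h.neg_half_le_reflectionDiff_last hc ha hC0
        (fun k x M => hC k x₀ ν a x M) hl hCl hfar hN0 (fun k x hx => hN (k, ⟨x, hx⟩)) p.1 p.2 p.2.2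
    rw [reflectionDiff]
    linarith [(abs_le.mp (hB p.1 (hyperplaneReflection x₀ ν a p.2))).1,
      (abs_le.mp (hB p.1 p.2)).2, hM p.1, le_abs_self M]
  exact fun k i hi x hx => by
    simpa using (h.isNavierChain k).neg_le_reflectionDiff_of_last hc ha hl.2.le (hfar k) le_rfl
      (fun y hy => by simpa using hlast (k, ⟨y, hy⟩)) hi x hx

theorem eventually_reflectionDiffNonneg_cap (hc : HasReflectingCaps Ω x₀ ν δ) (ha : a ≤ δ)
    (hnonneg : ReflectionDiffNonneg m w x₀ ν a (cap Ω x₀ ν a)) {b : ℝ} (hb : b < a) :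
    ∀ᶠ a' in 𝓝 a, ReflectionDiffNonneg m w x₀ ν a' (cap Ω x₀ ν b) := by
  refine eventually_all.mpr fun k => (eventually_all_finite (finite_Iic (m k))).mpr fun i hi => ?_
  filter_upwards [eventually_forall_cap_reflectionDiff_pos hc.isCompact_closure
    ((h.isNavierChain k).continuous i hi) (h.reflectionDiff_pos_of_mem_cap hc ha hnonneg hb k hi)]
    with a' hpos x hx using (hpos x hx).le

theorem reflectionDiffNonneg_cap (hc : HasReflectingCaps Ω x₀ ν δ) (ha : a ∈ Icc 0 δ) :
    ReflectionDiffNonneg m w x₀ ν a (cap Ω x₀ ν a) := by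
  obtain ⟨l, hl, hnarrow⟩ := h.exists_reflectionDiffNonneg_of_far hc
  refine (h.isClosed_setOf_reflectionDiffNonneg.inter
    isClosed_Icc).Icc_subset_of_forall_mem_nhdsWithin ?_ ?_ ha
  · refine hnarrow 0 (ha.1.trans ha.2) fun k i _ x hx => ?_
    linarith [hc.inner_nonneg x hx.1, hx.2]
  · rintro b ⟨hb, -, hbδ⟩
    filter_upwards [(h.eventually_reflectionDiffNonneg_cap hc hbδ.le hb
      (sub_lt_self b (half_pos hl))).filter_mono nhdsWithin_le_nhds,
      Ioo_mem_nhdsGT (lt_min hbδ (lt_add_of_pos_right b (half_pos hl)))] with a' hfar ⟨_, ha'⟩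
    have ha'l : a' - l ≤ b - l / 2 := by linarith [ha'.le.trans (min_le_right _ _)]
    exact hnarrow a' (ha'.le.trans (min_le_left _ _)) fun k i hi x hx =>
      hfar k i hi x ⟨hx.1, hx.2.trans ha'l⟩

theorem strictlyIncreasingAlong (hc : HasReflectingCaps Ω x₀ ν δ) (k : ι) {i : ℕ} (hi : i ≤ m k) :
    StrictlyIncreasingAlong ν (boundaryLayer Ω x₀ ν δ) (w k i) := by
  rintro x ⟨hx, hx0, -⟩ t ht ⟨-, -, hxt⟩
  rw [add_sub_right_comm, inner_add_left, real_inner_smul_left, real_inner_self_eq_norm_sq,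
    hc.norm_eq_one, one_pow, mul_one] at hxt
  have ha : inner ℝ (x - x₀) ν + t / 2 ∈ Icc 0 δ := ⟨by linarith, by linarith⟩
  have hpos := h.reflectionDiff_pos_of_mem_cap hc ha.2 (h.reflectionDiffNonneg_cap hc ha)
    (lt_add_of_pos_right _ (half_pos ht)) k hi x ⟨hx, le_rfl⟩
  rwa [reflectionDiff, hyperplaneReflection_eq_add_smul (add_sub_cancel_right _ _).symm,
    sub_pos] at hpos

end IsNavierSystem

end NavierSystem

/-! ### From polyharmonic systems to coupled chains -/

section IterNegLaplacian

variable {n : ℕ} {Ω s : Set (En n)} {u f : En n → ℝ} {m i : ℕ} {σ : ℝ} {x x₀ ν : En n}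

theorem contDiffOn_iterate_neg_laplacianWithin (hs : UniqueDiffOn ℝ s)
    (hu : ContDiffOn ℝ (2 * m : ℕ) u s) (hi : i ≤ m) :
    ContDiffOn ℝ (2 * (m - i) : ℕ)
      ((fun (g : En n → ℝ) y => -InnerProductSpace.laplacianWithin g s y)^[i] u) s := by
  induction i with
  | zero => exact hu
  | succ k ih =>
    rw [Function.iterate_succ_apply']
    exact (contDiffOn_laplacianWithin (ih (by omega)) hs
      (by exact_mod_cast (by omega : 2 * (m - (k + 1)) + 2 ≤ 2 * (m - k)))).neg

theorem iterNegLaplacian_zero : iterNegLaplacian Ω 0 u = u :=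
  funext fun _ => ite_self _

theorem eqOn_iterNegLaplacian_closure (Ω : Set (En n)) (i : ℕ) (u : En n → ℝ) :
    EqOn (iterNegLaplacian Ω i u)
      ((fun (g : En n → ℝ) y => -InnerProductSpace.laplacianWithin g (closure Ω) y)^[i] u)
      (closure Ω) :=
  fun _ hx => if_pos hx

theorem contDiffOn_iterNegLaplacian_closure (hs : UniqueDiffOn ℝ (closure Ω))
    (hu : ContDiffOn ℝ (2 * m : ℕ) u (closure Ω)) (hi : i ≤ m) :
    ContDiffOn ℝ (2 * (m - i) : ℕ) (iterNegLaplacian Ω i u) (closure Ω) :=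
  (contDiffOn_iterate_neg_laplacianWithin hs hu hi).congr (eqOn_iterNegLaplacian_closure Ω i u)

theorem laplacian_iterNegLaplacian (hs : UniqueDiffOn ℝ (closure Ω))
    (hx : x ∈ interior (closure Ω)) :
    Laplacian.laplacian (iterNegLaplacian Ω i u) x = -iterNegLaplacian Ω (i + 1) u x := by
  rw [(InnerProductSpace.laplacian_congr_nhds ((eqOn_iterNegLaplacian_closure Ω i
      u).eventuallyEq_of_mem (mem_interior_iff_mem_nhds.mp hx))).eq_of_nhds,
    eqOn_iterNegLaplacian_closure Ω (i + 1) u (interior_subset hx), Function.iterate_succ_apply',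
    laplacianWithin_eq_laplacian_of_mem_interior hs hx, neg_neg]

theorem IsExposedBoundaryPoint.isNavierChain (hx₀ : IsExposedBoundaryPoint Ω x₀ ν)
    (hσ : σ ∈ Ioo (0 : ℝ) 1) (hu : ContDiffOn ℝ (2 * m : ℕ) u (closure Ω))
    (hout : ∀ i ≤ m, ∀ x ∉ Ω, iterNegLaplacian Ω i u x = 0)
    (heq : ∀ x ∈ Ω, HasFracLaplacianAt σ (iterNegLaplacian Ω m u) x (f x))
    (hf : ∀ x ∈ Ω, 0 < f x) : IsNavierChain Ω m σ (fun i => iterNegLaplacian Ω i u) f where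
  exponent_mem := hσ
  continuous i hi := by
    have hunion := (contDiffOn_iterNegLaplacian_closure hx₀.uniqueDiffOn_closure hu
      hi).continuousOn.union_of_isClosed (t := Ωᶜ) (continuousOn_const.congr (hout i hi))
      isClosed_closure hx₀.isOpen.isClosed_compl
    rwa [compl_subset_iff_union.mp (compl_subset_compl.mpr subset_closure),
      continuousOn_univ] at hunion
  eq_zero := hout
  contDiffAt i hi x hx :=
    ((contDiffOn_iterNegLaplacian_closure hx₀.uniqueDiffOn_closure hu hi.le).contDiffAt
      (mem_of_superset (hx₀.isOpen.mem_nhds hx) subset_closure)).of_le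
        (by exact_mod_cast (by omega : 2 ≤ 2 * (m - i)))
  laplacian_eq i _ x hx :=
    laplacian_iterNegLaplacian hx₀.uniqueDiffOn_closure (hx₀.interior_closure.symm ▸ hx)
  hasFracLaplacianAt := heq
  rhs_pos := hf

end IterNegLaplacian

/-- `u` is a family of positive classical solutions of `(-Δ)^{m k + σ k} (u k) = F k (u (τ k))` in
`Ω` with Navier exterior conditions. The map `τ` says which unknown stands on the right-hand side
of which equation; the two equations of `IsPositiveSolution` are the case `ι = Bool`, `τ = not`. -/
structure IsPositiveSystemSolution {n : ℕ} {ι : Type*} (Ω : Set (En n)) (m : ι → ℕ) (σ : ι → ℝ)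
    (F : ι → ℝ → ℝ) (τ : ι → ι) (u : ι → En n → ℝ) : Prop where
  contDiffOn : ∀ k, ContDiffOn ℝ (2 * m k : ℕ) (u k) (closure Ω)
  pos : ∀ k, ∀ x ∈ Ω, 0 < u k x
  hasFracLaplacianAt : ∀ k, ∀ x ∈ Ω,
    HasFracLaplacianAt (σ k) (iterNegLaplacian Ω (m k) (u k)) x (F k (u (τ k) x))
  navier : ∀ k, ∀ i ≤ m k, ∀ x ∉ Ω, iterNegLaplacian Ω i (u k) x = 0

theorem IsPositiveSystemSolution.isNavierSystem {n : ℕ} {ι : Type*} {Ω : Set (En n)} {m : ι → ℕ}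
    {σ : ι → ℝ} {F : ι → ℝ → ℝ} {τ : ι → ι} {u : ι → En n → ℝ} {x₀ ν : En n}
    (h : IsPositiveSystemSolution Ω m σ F τ u) (hx₀ : IsExposedBoundaryPoint Ω x₀ ν)
    (hσ : ∀ k, σ k ∈ Ioo (0 : ℝ) 1) (hF : ∀ k, IsMonotoneNonlinearity (F k)) :
    IsNavierSystem Ω m σ F τ fun k i => iterNegLaplacian Ω i (u k) where
  nonlinearity := hF
  isNavierChain k := by
    simp only [iterNegLaplacian_zero]
    exact hx₀.isNavierChain (hσ k) (h.contDiffOn k) (h.navier k) (h.hasFracLaplacianAt k)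
      fun x hx => (hF k).pos _ (h.pos (τ k) x hx)

theorem IsPositiveSolution.isPositiveSystemSolution {n : ℕ} {Ω : Set (En n)} {s₀ t₀ : ℕ}
    {s₁ t₁ p q : ℝ} {u v : En n → ℝ} (h : IsPositiveSolution Ω s₀ t₀ s₁ t₁ p q u v) :
    IsPositiveSystemSolution Ω (cond · t₀ s₀) (cond · t₁ s₁) (fun k r => r ^ cond k q p) not
      (cond · v u) where
  contDiffOn := Bool.forall_bool.mpr ⟨h.admissible_u.2, h.admissible_v.2⟩
  pos := Bool.forall_bool.mpr ⟨h.pos_u, h.pos_v⟩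
  hasFracLaplacianAt := Bool.forall_bool.mpr ⟨h.eq_u, h.eq_v⟩
  navier := Bool.forall_bool.mpr ⟨h.navier_u, h.navier_v⟩

theorem lemma2p1_general {n : ℕ} {Ω : Set (En n)} {x₀ ν₀ : En n}
    (hx₀ : IsExposedBoundaryPoint Ω x₀ ν₀) :
    ∃ δ₀ : ℝ, 0 < δ₀ ∧
      ∀ (ι : Type*) [Finite ι] (m : ι → ℕ) (σ : ι → ℝ) (F : ι → ℝ → ℝ) (τ : ι → ι),
        (∀ k, σ k ∈ Ioo (0 : ℝ) 1) → (∀ k, IsMonotoneNonlinearity (F k)) →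
        ∀ u : ι → En n → ℝ, IsPositiveSystemSolution Ω m σ F τ u →
          ∀ k, ∀ i ≤ m k, StrictlyIncreasingAlong ν₀ (boundaryLayer Ω x₀ ν₀ δ₀)
            (iterNegLaplacian Ω i (u k)) := by
  obtain ⟨δ, hδ, hc⟩ := hx₀.exists_hasReflectingCaps
  exact ⟨δ, hδ, fun ι _ m σ F τ hσ hF u h k i hi =>
    (h.isNavierSystem hx₀ hσ hF).strictlyIncreasingAlong hc k hi⟩

theorem lemma2p1 (n : ℕ) (hn : 1 ≤ n) (Ω : Set (En n)) (hΩ : IsSmoothStrictlyConvexDomain Ω)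
    (x₀ : En n) (hx₀ : x₀ ∈ frontier Ω) (ν₀ : En n) (hν₀ : IsInwardUnitNormal Ω x₀ ν₀) :
    ∃ δ₀ : ℝ, 0 < δ₀ ∧
      ∀ (s₀ t₀ : ℕ) (s₁ t₁ p q : ℝ), 1 ≤ s₀ → 1 ≤ t₀ →
        s₁ ∈ Set.Ioo (0 : ℝ) 1 → t₁ ∈ Set.Ioo (0 : ℝ) 1 → 1 ≤ p → 1 ≤ q →
        ∀ u v : En n → ℝ, IsPositiveSolution Ω s₀ t₀ s₁ t₁ p q u v →
          (∀ i ≤ s₀, StrictlyIncreasingAlong ν₀ (boundaryLayer Ω x₀ ν₀ δ₀)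
            (iterNegLaplacian Ω i u)) ∧
          (∀ j ≤ t₀, StrictlyIncreasingAlong ν₀ (boundaryLayer Ω x₀ ν₀ δ₀)
            (iterNegLaplacian Ω j v)) := by
  obtain ⟨δ, hδ, hmono⟩ := lemma2p1_general (hΩ.isExposedBoundaryPoint hx₀ hν₀)
  exact ⟨δ, hδ, fun s₀ t₀ s₁ t₁ p q _ _ hs₁ ht₁ hp hq u v h => Bool.forall_bool.mp
    (hmono Bool _ _ _ _ (Bool.forall_bool.mpr ⟨hs₁, ht₁⟩) (Bool.forall_bool.mpr
      ⟨isMonotoneNonlinearity_rpow hp, isMonotoneNonlinearity_rpow hq⟩) _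
      h.isPositiveSystemSolution)⟩
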